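/- Let $A_0=\mathbb R$ with trivial conjugation and, for $n\ge 1$, let $A_n=A_{n-1}\times A_{n-1}$ be the Cayley-Dickson algebra with conjugation $(a,b)^*=(a^*,-b)$ and multiplication $(a,b)(c,d)=(ac-d^*b,\;da+bc^*)$; its unit is $1=(1,0)$. Equip $A_n$ with the real inner product $\langle a,b\rangle=\operatorname{Re}(ab^*)$, where $\operatorname{Re}(x)=\tfrac12(x+x^*)\in\mathbb R\cdot 1$, and write $\|a\|=\sqrt{\langle a,a\rangle}$ and $\perp$ for orthogonality with respect to it. For $n\ge1$ let $i_n=(0,1)\in A_n$, let $\mathbb C_n=\mathbb R\cdot 1+\mathbb R\cdot i_n\subset A_n$, and let $\mathbb H_{n+1}\subset A_{n+1}$ be the real span of $(1,0),(0,1),(i_n,0),(0,i_n)$. Left multiplication makes $A_n$ a $\mathbb C_n$-vector space. Elements $a,b\in A_n$ are called $\mathbb C$-orthogonal if the orthogonal projection of $ab^*$ onto $\mathbb C_n$ is zero. For $a\in A_n$ let $\operatorname{Ann}a=\{x\in A_n: ax=0\}$. If $a,b\in A_n$ and there is a unique $x\in A_n$ with $ax=b$ and $x\perp\operatorname{Ann}a$,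 this $x$ is denoted $\frac ba$. For $a,b\in\mathbb C_n^\perp$ put $$\{a,b\}=\tfrac1{\sqrt2}\bigl(a+b,\;i_n(-a+b)\bigr)\in A_{n+1}.$$ The $D$-locus in $A_{n+1}$ is the set of all $\{a,b\}$ with $a,b\in\mathbb C_n^\perp$ such that $a$ and $b$ are $\mathbb C$-orthogonal, $a\perp\operatorname{Ann}b$ and $b\perp\operatorname{Ann}a$. Theorem. Let $n\ge1$ and let $a$ and $b$ be non-zero elements of $\mathbb C_n^\perp\subset A_n$. 1. If $\{a,b\}$ does not belong to the $D$-locus in $A_{n+1}$, then $\operatorname{Ann}\{a,b\}\subseteq\mathbb H_{n+1}^\perp$ and $\dim_{\mathbb R}\operatorname{Ann}\{a,b\}=\dim_{\mathbb R}\operatorname{Ann}a+\dim_{\mathbb R}\operatorname{Ann}b$. 2. If $\{a,b\}$ belongs to the $D$-locus in $A_{n+1}$, then $\frac ba$ and $\frac ab$ exist, and $\operatorname{Ann}\{a,b\}$ is the $\mathbb C$-orthogonal direct sum of the following $\mathbb C_{n+1}$-linear subspaces of $A_{n+1}$: - the space of all $\{x,y\}$ with $x\in\operatorname{Ann}a$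 and $y\in\operatorname{Ann}b$; - the $\mathbb C_{n+1}$-linear span of $\{\|b\|^2a,\,-\|a\|^2b\}$; - the $\mathbb C_{n+1}$-linear span of $\bigl\{\frac ba,\,-\frac ab\bigr\}+\sqrt2\,(0,i_n)$. In particular $\dim_{\mathbb R}\operatorname{Ann}\{a,b\}=\dim_{\mathbb R}\operatorname{Ann}a+\dim_{\mathbb R}\operatorname{Ann}b+4$. -/

import Mathlib

noncomputable section

namespace CayleyDickson

/-- The underlying space of the Cayley-Dickson algebra `A_n`, of real dimension `2 ^ n`. -/
def A : ℕ → Type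
  | 0 => ℝ
  | n + 1 => A n × A n

instance instAddCommGroup : (n : ℕ) → AddCommGroup (A n)
  | 0 => inferInstanceAs (AddCommGroup ℝ)
  | n + 1 =>
    letI := instAddCommGroup n
    inferInstanceAs (AddCommGroup (A n × A n))

instance instModule : (n : ℕ) → Module ℝ (A n)
  | 0 => inferInstanceAs (Module ℝ ℝ)
  | n + 1 =>
    letI := instModule n
    inferInstanceAs (Module ℝ (A n × A n))

/-- The pair `(x, y)` as an element of `A_{n+1}`. -/
def mk {n : ℕ} (x y : A n) : A (n + 1) := (x, y)

/-- First component of an element of `A_{n+1}`. -/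
def fstₗ (n : ℕ) : A (n + 1) →ₗ[ℝ] A n := LinearMap.fst ℝ (A n) (A n)

/-- Second component of an element of `A_{n+1}`. -/
def sndₗ (n : ℕ) : A (n + 1) →ₗ[ℝ] A n := LinearMap.snd ℝ (A n) (A n)

/-- The coordinate inclusion `x ↦ (x, 0)`. -/
def inlₗ (n : ℕ) : A n →ₗ[ℝ] A (n + 1) := LinearMap.inl ℝ (A n) (A n)

/-- The coordinate inclusion `y ↦ (0, y)`. -/
def inrₗ (n : ℕ) : A n →ₗ[ℝ] A (n + 1) := LinearMap.inr ℝ (A n) (A n)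

/-- Conjugation: `(a, b)^* = (a^*, -b)`, trivial on `A_0 = ℝ`. -/
def conjₗ : (n : ℕ) → A n →ₗ[ℝ] A n
  | 0 => LinearMap.id
  | n + 1 => inlₗ n ∘ₗ conjₗ n ∘ₗ fstₗ n - inrₗ n ∘ₗ sndₗ n

/-- The (bilinear) multiplication `(a, b)(c, d) = (a c - d^* b, d a + b c^*)`;
see `mk_mul_mk` for this formula. -/
def mulₗ : (n : ℕ) → A n →ₗ[ℝ] A n →ₗ[ℝ] A n
  | 0 => LinearMap.mul ℝ ℝ
  | n + 1 =>
    ((mulₗ n).compl₁₂ (fstₗ n) (fstₗ n)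
        - (mulₗ n).flip.compl₁₂ (sndₗ n) (conjₗ n ∘ₗ sndₗ n)).compr₂ (inlₗ n)
      + ((mulₗ n).flip.compl₁₂ (fstₗ n) (sndₗ n)
        + (mulₗ n).compl₁₂ (sndₗ n) (conjₗ n ∘ₗ fstₗ n)).compr₂ (inrₗ n)

instance (n : ℕ) : Mul (A n) := ⟨fun x y => mulₗ n x y⟩

instance (n : ℕ) : Star (A n) := ⟨fun x => conjₗ n x⟩

/-- The unit element: `1` in `A_0 = ℝ` and `(1, 0)` in `A_{n+1}`. -/
def unit : (n : ℕ) → A n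
  | 0 => (1 : ℝ)
  | n + 1 => mk (unit n) 0

instance (n : ℕ) : One (A n) := ⟨unit n⟩

/-- The element `i_{n+1} = (0, 1)` of `A_{n+1}`. -/
def im (n : ℕ) : A (n + 1) := mk 0 1

theorem mk_add {n : ℕ} (a b c d : A n) : mk a b + mk c d = mk (a + c) (b + d) := rfl

theorem smul_mk {n : ℕ} (r : ℝ) (a b : A n) : r • mk a b = mk (r • a) (r • b) := rfl

theorem mk_eta {n : ℕ} (x : A (n + 1)) : ∃ a b : A n, x = mk a b := ⟨x.1, x.2, rfl⟩

theorem star_mk {n : ℕ} (a b : A n) : star (mk a b) = mk (star a) (-b) := by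
  change (conjₗ n a, (0 : A n)) - ((0 : A n), b) = (conjₗ n a, -b)
  simp

theorem mk_mul_mk {n : ℕ} (a b c d : A n) :
    mk a b * mk c d = mk (a * c - star d * b) (d * a + b * star c) := by
  change (mulₗ n a c - mulₗ n (conjₗ n d) b, (0 : A n))
      + ((0 : A n), mulₗ n d a + mulₗ n b (conjₗ n c))
    = (mulₗ n a c - mulₗ n (conjₗ n d) b, mulₗ n d a + mulₗ n b (conjₗ n c))
  simp

theorem mul_def' {n : ℕ} (x y : A n) : x * y = mulₗ n x y := rfl

theorem star_def' {n : ℕ} (x : A n) : star x = conjₗ n x := rfl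

/-- The real part, as a real number; see `re_smul_one`. -/
def re : (n : ℕ) → A n →ₗ[ℝ] ℝ
  | 0 => LinearMap.id
  | n + 1 => re n ∘ₗ fstₗ n

theorem re_mk {n : ℕ} (a b : A n) : re (n + 1) (mk a b) = re n a := rfl

/-- The real part `re x`, regarded as an element of `ℝ · 1`, is `(x + x^*) / 2`. -/
theorem re_smul_one : ∀ (n : ℕ) (x : A n), re n x • (1 : A n) = (1 / 2 : ℝ) • (x + star x)
  | 0, x => by
    have h : ∀ t : ℝ, t * 1 = (1 / 2 : ℝ) * (t + t) := fun t => by ring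
    exact h x
  | n + 1, x => by
    obtain ⟨a, b, rfl⟩ := mk_eta x
    have h1 : (1 : A (n + 1)) = mk 1 0 := rfl
    rw [h1, smul_mk, star_mk, mk_add, smul_mk, re_mk, re_smul_one n a]
    simp

theorem re_star : ∀ (n : ℕ) (x : A n), re n (star x) = re n x
  | 0, _ => rfl
  | n + 1, x => by
    obtain ⟨a, b, rfl⟩ := mk_eta x
    rw [star_mk, re_mk, re_mk, re_star n a]

theorem star_star' : ∀ (n : ℕ) (x : A n), star (star x) = x
  | 0, _ => rfl
  | n + 1, x => by
    obtain ⟨a, b, rfl⟩ := mk_eta x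
    rw [star_mk, star_mk, star_star' n a, neg_neg]

theorem star_mul' : ∀ (n : ℕ) (x y : A n), star (x * y) = star y * star x
  | 0, x, y => mul_comm (G := ℝ) x y
  | n + 1, x, y => by
    obtain ⟨a, b, rfl⟩ := mk_eta x
    obtain ⟨c, d, rfl⟩ := mk_eta y
    have e1 : star (a * c - star d * b) = star c * star a - star (-b) * -d := by
      have h1 := star_mul' n a c
      have h2 := star_mul' n (star d) b
      rw [star_star'] at h2
      simp only [mul_def', star_def', map_sub, map_neg, LinearMap.neg_apply, neg_neg] at *
      rw [h1, h2]
    have e2 : -(d * a + b * star c) = -b * star c + -d * star (star a) := by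
      rw [star_star']
      simp only [mul_def', map_neg, LinearMap.neg_apply]
      abel
    rw [mk_mul_mk, star_mk, star_mk, star_mk, mk_mul_mk, e1, e2]

theorem re_mul_comm : ∀ (n : ℕ) (x y : A n), re n (x * y) = re n (y * x)
  | 0, x, y => mul_comm (G := ℝ) x y
  | n + 1, x, y => by
    obtain ⟨a, b, rfl⟩ := mk_eta x
    obtain ⟨c, d, rfl⟩ := mk_eta y
    rw [mk_mul_mk, mk_mul_mk, re_mk, re_mk, map_sub, map_sub, re_mul_comm n a c,
      ← re_star n (star d * b), star_mul', star_star']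

theorem re_mk_mul_star {n : ℕ} (a b c d : A n) :
    re (n + 1) (mk a b * star (mk c d)) = re n (a * star c) + re n (b * star d) := by
  rw [star_mk, mk_mul_mk, re_mk, re_mul_comm n b (star d)]
  simp only [mul_def', star_def', map_neg, LinearMap.neg_apply, sub_neg_eq_add, map_add]

theorem re_mul_star_self_nonneg : ∀ (n : ℕ) (x : A n), 0 ≤ re n (x * star x)
  | 0, x => mul_self_nonneg (R := ℝ) x
  | n + 1, x => by
    obtain ⟨a, b, rfl⟩ := mk_eta x
    rw [re_mk_mul_star]
    exact add_nonneg (re_mul_star_self_nonneg n a) (re_mul_star_self_nonneg n b)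

theorem eq_zero_of_re_mul_star_self : ∀ (n : ℕ) (x : A n), re n (x * star x) = 0 → x = 0
  | 0, x, h => mul_self_eq_zero (M₀ := ℝ) (a := x).mp h
  | n + 1, x, h => by
    obtain ⟨a, b, rfl⟩ := mk_eta x
    rw [re_mk_mul_star] at h
    have ha := re_mul_star_self_nonneg n a
    have hb := re_mul_star_self_nonneg n b
    rw [eq_zero_of_re_mul_star_self n a (by linarith), eq_zero_of_re_mul_star_self n b (by linarith)]
    rfl

/-- The real inner product `⟨a, b⟩ = Re (a b^*)`. -/
@[reducible]
def innerCore (n : ℕ) : InnerProductSpace.Core ℝ (A n) where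
  inner a b := re n (a * star b)
  conj_inner_symm a b := by
    rw [← re_star n (b * star a), star_mul', star_star']
    rfl
  re_inner_nonneg a := re_mul_star_self_nonneg n a
  add_left a b c := by simp [mul_def']
  smul_left a b r := by simp [mul_def']
  definite a h := eq_zero_of_re_mul_star_self n a h

instance (n : ℕ) : NormedAddCommGroup (A n) := (innerCore n).toNormedAddCommGroup

instance (n : ℕ) : InnerProductSpace ℝ (A n) := InnerProductSpace.ofCore (innerCore n).toCore

theorem inner_eq_re {n : ℕ} (a b : A n) : inner ℝ a b = re n (a * star b) := rfl

instance instFiniteDimensional : (n : ℕ) → FiniteDimensional ℝ (A n)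
  | 0 => inferInstanceAs (FiniteDimensional ℝ ℝ)
  | n + 1 =>
    letI := instFiniteDimensional n
    inferInstanceAs (FiniteDimensional ℝ (A n × A n))

/-- `ℂ_{n+1}`, the real span of `1` and `i_{n+1}` in `A_{n+1}`. -/
def C (n : ℕ) : Submodule ℝ (A (n + 1)) := Submodule.span ℝ {1, im n}

/-- `ℍ_{n+2}`, the real span of `(1,0)`, `(0,1)`, `(i_{n+1},0)`, `(0,i_{n+1})` in `A_{n+2}`. -/
def H (n : ℕ) : Submodule ℝ (A (n + 2)) :=
  Submodule.span ℝ {mk 1 0, mk 0 1, mk (im n) 0, mk 0 (im n)}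

/-- The Hermitian inner product: the orthogonal projection of `a b^*` onto `ℂ_{n+1}`. -/
def herm {n : ℕ} (a b : A (n + 1)) : A (n + 1) := (C n).starProjection (a * star b)

/-- The annihilator of `a`: all `x` with `a x = 0`. -/
def Ann {n : ℕ} (a : A n) : Submodule ℝ (A n) := LinearMap.ker (mulₗ n a)

theorem mem_Ann {n : ℕ} {a x : A n} : x ∈ Ann a ↔ a * x = 0 := LinearMap.mem_ker

/-- The element `{a, b} = (1/√2) (a + b, i (-a + b))` of `A_{n+2}`, for `a, b` in `A_{n+1}`
(used only for `a, b` orthogonal to `ℂ_{n+1}`). -/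
def bracket {n : ℕ} (a b : A (n + 1)) : A (n + 2) :=
  (1 / √2 : ℝ) • mk (a + b) (im n * (-a + b))

/-- The `D`-locus in `A_{n+2}`. -/
def DLocus (n : ℕ) : Set (A (n + 2)) :=
  {z | ∃ a ∈ (C n)ᗮ, ∃ b ∈ (C n)ᗮ, z = bracket a b ∧
    herm a b = 0 ∧ a ∈ (Ann b)ᗮ ∧ b ∈ (Ann a)ᗮ}

/-- `q` is the quotient `b / a`: it satisfies `a q = b` and is orthogonal to `Ann a`. -/
def IsQuotient {n : ℕ} (b a q : A n) : Prop := a * q = b ∧ q ∈ (Ann a)ᗮ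

/-- The `ℂ_{n+1}`-linear span `{α v : α ∈ ℂ_{n+1}}` of a single element `v` of `A_{n+1}`,
which is a complex vector space under left multiplication. -/
def cSpan {n : ℕ} (v : A (n + 1)) : Submodule ℝ (A (n + 1)) :=
  (C n).map ((mulₗ (n + 1)).flip v)

theorem mem_cSpan {n : ℕ} {v w : A (n + 1)} : w ∈ cSpan v ↔ ∃ α ∈ C n, α * v = w := Iff.rfl

/-- The real-linear map `(x, y) ↦ {x, y}`. -/
def bracketₗ (n : ℕ) : A (n + 1) × A (n + 1) →ₗ[ℝ] A (n + 2) where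
  toFun p := bracket p.1 p.2
  map_add' p q := by
    simp only [bracket, mul_def', Prod.fst_add, Prod.snd_add, neg_add, map_add, map_neg, ← smul_add,
      mk_add]
    congr 2 <;> abel
  map_smul' r p := by
    simp only [bracket, mul_def', Prod.smul_fst, Prod.smul_snd, RingHom.id_apply,
      smul_comm r (1 / √2 : ℝ), smul_mk, map_add, map_neg, map_smul, smul_add, smul_neg]

/-- The space of all `{x, y}` with `x` in `U` and `y` in `V`. -/
def bracketSpace {n : ℕ} (U V : Submodule ℝ (A (n + 1))) : Submodule ℝ (A (n + 2)) :=
  (U.prod V).map (bracketₗ n)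

theorem mem_bracketSpace {n : ℕ} {U V : Submodule ℝ (A (n + 1))} {z : A (n + 2)} :
    z ∈ bracketSpace U V ↔ ∃ x ∈ U, ∃ y ∈ V, bracket x y = z := by
  constructor
  · rintro ⟨p, ⟨h1, h2⟩, h⟩
    exact ⟨p.1, h1, p.2, h2, h⟩
  · rintro ⟨x, hx, y, hy, h⟩
    exact ⟨(x, y), ⟨hx, hy⟩, h⟩

/-- `W` is the `ℂ`-orthogonal direct sum of the family `V` of `ℂ_{n+1}`-linear subspaces
of `A_{n+1}`. -/
structure IsCOrthogonalDirectSum {n : ℕ} {ι : Type} (W : Submodule ℝ (A (n + 1)))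
    (V : ι → Submodule ℝ (A (n + 1))) : Prop where
  mul_mem : ∀ i, ∀ α ∈ C n, ∀ v ∈ V i, α * v ∈ V i
  herm_eq_zero : ∀ i j, i ≠ j → ∀ u ∈ V i, ∀ v ∈ V j, herm u v = 0
  indep : iSupIndep V
  iSup_eq : ⨆ i, V i = W

end CayleyDickson

end

/-! Write `i` for `im n`. For `p` orthogonal to `C n`, left multiplication by `p` is skew-adjoint,
satisfies `p * p = -‖p‖²`, and anticommutes with left multiplication by `i` on `(C n)ᗮ`. Every
element of `A (n + 2)` is `bracket x y` plus a quaternion with coefficients `r₀, r₁, s₀, s₁`. In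
these coordinates (`bracket_mul_eq_zero_iff`), annihilation by `bracket a b` says that the parts of
`a * x` and `b * y` off `C n` are prescribed combinations of `a`, `i * a`, `b`, `i * b`, together
with two pairs of scalar conditions.

Pairing these equations with `a`, `i * a`, `b`, `i * b` forces `r₀ = s₀ = 0`; if `(r₁, s₁) ≠ 0`,
they force `bracket a b` into the D-locus (`quaternion_part_of_mem_Ann`). When the quaternion part
vanishes, `a * x` and `b * y` lie in `C n`, so `x` is in `Ann a` plus complex multiples of `a`, and
`y` in `Ann b` plus complex multiples of `b`. The first scalar pair ties the two complex
coefficients together, leaving `Ann a × Ann b × ℝ²` (`param`); the second pair is a linear map to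
`ℝ²` (`obstruction`).

Off the D-locus the obstruction is surjective, and its rank 2 cancels the two extra parameters. On
the D-locus it vanishes, and the quotients `b / a` and `a / b` realize the quaternion directions
`r₁, s₁`, adding two more dimensions. -/

namespace CayleyDickson

/-! ### Bilinearity, the trace form and adjoints of multiplications. -/

section Algebra

variable {n : ℕ}

theorem mul_add_ (x y z : A n) : x * (y + z) = x * y + x * z := by simp [mul_def']
theorem add_mul_ (x y z : A n) : (x + y) * z = x * z + y * z := by simp [mul_def']
theorem mul_sub_ (x y z : A n) : x * (y - z) = x * y - x * z := by simp [mul_def']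
theorem sub_mul_ (x y z : A n) : (x - y) * z = x * z - y * z := by simp [mul_def']
theorem mul_neg_ (x y : A n) : x * -y = -(x * y) := by simp [mul_def']
theorem neg_mul_ (x y : A n) : -x * y = -(x * y) := by simp [mul_def']
theorem mul_smul_ (r : ℝ) (x y : A n) : x * r • y = r • (x * y) := by simp [mul_def']
theorem smul_mul_ (r : ℝ) (x y : A n) : r • x * y = r • (x * y) := by simp [mul_def']
theorem mul_zero_ (x : A n) : x * 0 = 0 := by simp [mul_def']
theorem zero_mul_ (x : A n) : 0 * x = 0 := by simp [mul_def']
theorem star_add_ (x y : A n) : star (x + y) = star x + star y := by simp [star_def']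
theorem star_sub_ (x y : A n) : star (x - y) = star x - star y := by simp [star_def']
theorem star_neg_ (x : A n) : star (-x) = -star x := by simp [star_def']
theorem star_smul_ (r : ℝ) (x : A n) : star (r • x) = r • star x := by simp [star_def']
theorem star_zero_ : star (0 : A n) = 0 := by simp [star_def']

theorem one_eq_mk : (1 : A (n + 1)) = mk 1 0 := rfl

theorem zero_eq_mk : (0 : A (n + 1)) = mk 0 0 := rfl

theorem neg_mk (a b : A n) : -mk a b = mk (-a) (-b) := rfl

theorem mk_inj {a b c d : A n} : mk a b = mk c d ↔ a = c ∧ b = d := Prod.mk_inj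

theorem star_one_ : ∀ n : ℕ, star (1 : A n) = 1
  | 0 => rfl
  | n + 1 => by rw [one_eq_mk, star_mk, star_one_ n, neg_zero]

theorem one_mul_ : ∀ (n : ℕ) (x : A n), 1 * x = x
  | 0, x => one_mul (M := ℝ) x
  | n + 1, x => by
    obtain ⟨a, b, rfl⟩ := mk_eta x
    have hb : b * 1 = b := by
      rw [← star_star' n (b * 1), star_mul', star_one_, one_mul_ n, star_star']
    rw [one_eq_mk, mk_mul_mk, one_mul_ n a, hb, mul_zero_, zero_mul_, sub_zero, add_zero]

theorem mul_one_ (x : A n) : x * 1 = x := by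
  rw [← star_star' n (x * 1), star_mul', star_one_, one_mul_, star_star']

theorem re_one : ∀ n : ℕ, re n (1 : A n) = 1
  | 0 => rfl
  | n + 1 => by rw [one_eq_mk, re_mk, re_one n]

/-- Associativity survives under the real part even when the product is not associative. This makes
multiplication by `star x` adjoint to multiplication by `x`, on either side. -/
theorem re_mul_assoc : ∀ (n : ℕ) (x y z : A n), re n (x * y * z) = re n (x * (y * z))
  | 0, x, y, z => mul_assoc (G := ℝ) x y z
  | n + 1, x, y, z => by
    obtain ⟨a, b, rfl⟩ := mk_eta x
    obtain ⟨c, d, rfl⟩ := mk_eta y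
    obtain ⟨e, f, rfl⟩ := mk_eta z
    simp only [mk_mul_mk, re_mk, mul_add_, add_mul_, mul_sub_, sub_mul_, map_add, map_sub,
      star_add_, star_mul', star_star', re_mul_assoc n]
    have h1 : re n (star d * (b * e)) = re n (e * (star d * b)) := by
      rw [re_mul_comm n e, re_mul_assoc n]
    have h2 : re n (star f * (d * a)) = re n (a * (star f * d)) := by
      rw [re_mul_comm n a, re_mul_assoc n]
    have h3 : re n (star f * (b * star c)) = re n (star c * (star f * b)) := by
      rw [re_mul_comm n (star c), re_mul_assoc n]
    rw [h1, h2, h3]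
    ring

theorem inner_mul_left_eq (x y z : A n) : inner ℝ (x * y) z = inner ℝ y (star x * z) := by
  rw [inner_eq_re, inner_eq_re, star_mul', star_star', re_mul_assoc, re_mul_comm, re_mul_assoc]

theorem inner_mul_right_eq (x y z : A n) : inner ℝ (x * y) z = inner ℝ x (z * star y) := by
  rw [inner_eq_re, inner_eq_re, star_mul', star_star', re_mul_assoc]

theorem mul_star_self (x : A n) : x * star x = (‖x‖ ^ 2) • (1 : A n) := by
  rw [← real_inner_self_eq_norm_sq, inner_eq_re, re_smul_one, star_mul', star_star']
  module

theorem inner_one_right (x : A n) : inner ℝ x 1 = re n x := by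
  rw [inner_eq_re, star_one_, mul_one_]

theorem inner_mk (a b c d : A n) : inner ℝ (mk a b) (mk c d) = inner ℝ a c + inner ℝ b d :=
  re_mk_mul_star a b c d

theorem star_eq_neg_of_re_eq_zero {x : A n} (h : re n x = 0) : star x = -x := by
  have := re_smul_one n x
  rw [h, zero_smul] at this
  have h2 : x + star x = (2 : ℝ) • ((1 / 2 : ℝ) • (x + star x)) := by module
  rw [← this, smul_zero] at h2
  exact (neg_eq_of_add_eq_zero_right h2).symm

end Algebra

/-! ### The complex structure and multiplication on the complement of `C n`. -/

section ComplexStructure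

variable {n : ℕ}

theorem inner_one_one : inner ℝ (1 : A n) 1 = 1 := by rw [inner_one_right, re_one]

theorem inner_one_im : inner ℝ (1 : A (n + 1)) (im n) = 0 := by
  rw [one_eq_mk, im, inner_mk]; simp

theorem inner_im_one : inner ℝ (im n) (1 : A (n + 1)) = 0 := by
  rw [real_inner_comm, inner_one_im]

theorem inner_im_im : inner ℝ (im n) (im n) = 1 := by
  rw [im, inner_mk, inner_one_one]; simp

theorem mem_C {x : A (n + 1)} : x ∈ C n ↔ ∃ r s : ℝ, r • 1 + s • im n = x :=
  Submodule.mem_span_pair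

theorem mem_C_orthogonal {x : A (n + 1)} :
    x ∈ (C n)ᗮ ↔ inner ℝ x 1 = 0 ∧ inner ℝ x (im n) = 0 := by
  rw [Submodule.mem_orthogonal']
  constructor
  · intro h
    exact ⟨h _ (mem_C.2 ⟨1, 0, by module⟩), h _ (mem_C.2 ⟨0, 1, by module⟩)⟩
  · rintro ⟨h1, h2⟩ u hu
    obtain ⟨r, s, rfl⟩ := mem_C.1 hu
    rw [inner_add_right, inner_smul_right, inner_smul_right, h1, h2]; simp

theorem star_of_mem {x : A (n + 1)} (h : x ∈ (C n)ᗮ) : star x = -x :=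
  star_eq_neg_of_re_eq_zero (by rw [← inner_one_right]; exact (mem_C_orthogonal.1 h).1)

theorem star_components_of_mem {a b : A n} (h : mk a b ∈ (C n)ᗮ) : star a = -a ∧ star b = -b := by
  obtain ⟨h1, h2⟩ := mem_C_orthogonal.1 h
  rw [one_eq_mk, inner_mk, inner_zero_right, add_zero, inner_one_right] at h1
  rw [im, inner_mk, inner_zero_right, zero_add, inner_one_right] at h2
  exact ⟨star_eq_neg_of_re_eq_zero h1, star_eq_neg_of_re_eq_zero h2⟩

theorem im_mul_mk (a b : A n) : im n * mk a b = mk (-star b) (star a) := by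
  rw [im, mk_mul_mk, mul_one_, one_mul_, zero_mul_, mul_zero_, zero_sub, zero_add]

theorem im_mul_im_mul (x : A (n + 1)) : im n * (im n * x) = -x := by
  obtain ⟨a, b, rfl⟩ := mk_eta x
  rw [im_mul_mk, im_mul_mk, star_neg_, star_star', star_star', neg_mk]

theorem star_im : star (im n) = -im n := by
  rw [im, star_mk, neg_mk, star_zero_, neg_zero]

theorem im_mul_im : im n * im n = -1 := by
  rw [← mul_one_ (im n * im n), ← im_mul_im_mul (n := n) 1, mul_one_, mul_one_]

theorem inner_im_mul_left (x y : A (n + 1)) : inner ℝ (im n * x) y = -inner ℝ x (im n * y) := by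
  rw [inner_mul_left_eq, star_im, neg_mul_, inner_neg_right]

theorem inner_im_mul_im_mul (x y : A (n + 1)) :
    inner ℝ (im n * x) (im n * y) = inner ℝ x y := by
  rw [inner_im_mul_left, im_mul_im_mul, inner_neg_right, neg_neg]

theorem inner_im_mul_self (x : A (n + 1)) : inner ℝ (im n * x) x = 0 := by
  have := inner_im_mul_left (n := n) x x
  rw [real_inner_comm x] at this
  rw [real_inner_comm]
  linarith

theorem norm_im_mul (x : A (n + 1)) : ‖im n * x‖ = ‖x‖ := by
  rw [norm_eq_sqrt_real_inner, norm_eq_sqrt_real_inner, inner_im_mul_im_mul]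

theorem im_mul_mem {x : A (n + 1)} (h : x ∈ (C n)ᗮ) : im n * x ∈ (C n)ᗮ := by
  obtain ⟨h1, h2⟩ := mem_C_orthogonal.1 h
  refine mem_C_orthogonal.2 ⟨?_, ?_⟩
  · rw [inner_im_mul_left, mul_one_, h2, neg_zero]
  · rw [inner_im_mul_left, im_mul_im, inner_neg_right, h1, neg_zero, neg_zero]

/-- On `(C n)ᗮ` both components of an element are purely imaginary, so conjugation only changes
signs and the two products can be compared componentwise. Left multiplication by `p` is thus
conjugate-linear there. -/
theorem mul_im_mul {p q : A (n + 1)} (hp : p ∈ (C n)ᗮ) (hq : q ∈ (C n)ᗮ) :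
    p * (im n * q) = -(im n * (p * q)) := by
  obtain ⟨a, b, rfl⟩ := mk_eta p
  obtain ⟨c, d, rfl⟩ := mk_eta q
  obtain ⟨ha, hb⟩ := star_components_of_mem hp
  obtain ⟨hc, hd⟩ := star_components_of_mem hq
  simp only [im_mul_mk, mk_mul_mk, neg_mk, star_sub_, star_add_, star_neg_, star_mul', ha, hb, hc,
    hd, mul_neg_, neg_mul_, neg_neg, mk_inj]
  constructor <;> abel

/-- Conjugation reverses products and negates `p` and `q`, so `q * p` is the conjugate of `p * q`.
-/
theorem mul_swap {p q : A (n + 1)} (hp : p ∈ (C n)ᗮ) (hq : q ∈ (C n)ᗮ) :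
    q * p = -(p * q) - (2 * inner ℝ p q) • (1 : A (n + 1)) := by
  have h := re_smul_one _ (p * q)
  rw [star_mul', star_of_mem hp, star_of_mem hq, neg_mul_, mul_neg_, neg_neg] at h
  have h2 : inner ℝ p q = -re _ (p * q) := by
    rw [inner_eq_re, star_of_mem hq, mul_neg_, map_neg]
  have h3 : (2 * inner ℝ p q) • (1 : A (n + 1)) = (-2 : ℝ) • (re _ (p * q) • (1 : A (n + 1))) := by
    rw [h2]; module
  rw [h3, h]; module

theorem im_mul_mul {p q : A (n + 1)} (hp : p ∈ (C n)ᗮ) (hq : q ∈ (C n)ᗮ) :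
    (im n * p) * q = im n * (q * p) + (2 * inner ℝ p (im n * q)) • (1 : A (n + 1)) := by
  rw [mul_swap hq (im_mul_mem hp), mul_im_mul hq hp, real_inner_comm, inner_im_mul_left]
  module

theorem mul_im {p : A (n + 1)} (hp : p ∈ (C n)ᗮ) : p * im n = -(im n * p) := by
  rw [← star_star' _ (p * im n), star_mul', star_im, star_of_mem hp, neg_mul_, mul_neg_, neg_neg]
  exact star_of_mem (im_mul_mem hp)

theorem mul_self_of_mem {p : A (n + 1)} (hp : p ∈ (C n)ᗮ) : p * p = -(‖p‖ ^ 2 • (1 : A (n + 1))) := by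
  rw [← mul_star_self, star_of_mem hp, mul_neg_, neg_neg]

theorem inner_mul_of_mem {p : A (n + 1)} (hp : p ∈ (C n)ᗮ) (x y : A (n + 1)) :
    inner ℝ (p * x) y = -inner ℝ x (p * y) := by
  rw [inner_mul_left_eq, star_of_mem hp, neg_mul_, inner_neg_right]

theorem inner_mul_one {p x : A (n + 1)} (hp : p ∈ (C n)ᗮ) :
    inner ℝ (p * x) 1 = -inner ℝ p x := by
  rw [inner_mul_of_mem hp, mul_one_, real_inner_comm]

theorem inner_mul_im {p x : A (n + 1)} (hp : p ∈ (C n)ᗮ) :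
    inner ℝ (p * x) (im n) = -inner ℝ p (im n * x) := by
  rw [inner_mul_of_mem hp, mul_im hp, inner_neg_right, neg_neg, real_inner_comm, inner_im_mul_left]

theorem inner_mul_self_right {p x : A (n + 1)} (hp : p ∈ (C n)ᗮ) (hx : x ∈ (C n)ᗮ) :
    inner ℝ (p * x) p = 0 := by
  rw [inner_mul_of_mem hp, mul_self_of_mem hp, inner_neg_right, inner_smul_right,
    (mem_C_orthogonal.1 hx).1]
  simp

theorem inner_mul_im_mul_self {p x : A (n + 1)} (hp : p ∈ (C n)ᗮ) (hx : x ∈ (C n)ᗮ) :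
    inner ℝ (p * x) (im n * p) = 0 := by
  rw [inner_mul_of_mem hp, mul_im_mul hp hp, mul_self_of_mem hp, mul_neg_, mul_smul_, mul_one_,
    inner_neg_right, inner_neg_right, inner_smul_right, (mem_C_orthogonal.1 hx).2]
  simp

/-- Move `a` across the inner products of `a * x = 0` with `a` and `im n * a`: since `a * a` is a
nonzero real, they become nonzero multiples of the pairings of `x` with `1` and `im n`. -/
theorem Ann_le {a : A (n + 1)} (ha : a ∈ (C n)ᗮ) (ha0 : a ≠ 0) : Ann a ≤ (C n)ᗮ := by
  intro x hx
  rw [mem_Ann] at hx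
  have hn : ‖a‖ ^ 2 ≠ 0 := by simpa using ha0
  have h1 := inner_mul_of_mem ha x a
  have h2 := inner_mul_of_mem ha x (im n * a)
  rw [hx, inner_zero_left, mul_self_of_mem ha, inner_neg_right, inner_smul_right, neg_neg] at h1
  rw [hx, inner_zero_left, mul_im_mul ha ha, mul_self_of_mem ha, mul_neg_, mul_smul_, mul_one_,
    neg_neg, inner_smul_right] at h2
  refine mem_C_orthogonal.2 ⟨?_, ?_⟩
  · exact (mul_eq_zero.1 h1.symm).resolve_left hn
  · exact (mul_eq_zero.1 (neg_eq_zero.1 h2.symm)).resolve_left hn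

theorem im_mul_mem_Ann {a x : A (n + 1)} (ha : a ∈ (C n)ᗮ) (ha0 : a ≠ 0) (hx : x ∈ Ann a) :
    im n * x ∈ Ann a := by
  rw [mem_Ann, mul_im_mul ha (Ann_le ha ha0 hx), mem_Ann.1 hx, mul_zero_, neg_zero]

/-- By adjointness, the coordinates of `a * star b` along `1` and `im n` are the two inner products
on the right. -/
theorem herm_eq_zero_iff {a b : A (n + 1)} :
    herm a b = 0 ↔ inner ℝ a b = 0 ∧ inner ℝ a (im n * b) = 0 := by
  rw [herm, Submodule.starProjection_apply_eq_zero_iff, mem_C_orthogonal, inner_mul_right_eq,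
    inner_mul_right_eq, star_star', one_mul_]

theorem herm_eq_zero_of_forall {U V : Submodule ℝ (A (n + 1))} (hV : ∀ v ∈ V, im n * v ∈ V)
    (h : ∀ u ∈ U, ∀ v ∈ V, inner ℝ u v = 0) {u v : A (n + 1)} (hu : u ∈ U) (hv : v ∈ V) :
    herm u v = 0 :=
  herm_eq_zero_iff.2 ⟨h u hu v hv, h u hu _ (hV v hv)⟩

theorem mem_cSpan_iff {v w : A (n + 1)} :
    w ∈ cSpan v ↔ ∃ r s : ℝ, r • v + s • (im n * v) = w := by
  rw [mem_cSpan]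
  constructor
  · rintro ⟨α, hα, rfl⟩
    obtain ⟨r, s, rfl⟩ := mem_C.1 hα
    exact ⟨r, s, by rw [add_mul_, smul_mul_, smul_mul_, one_mul_]⟩
  · rintro ⟨r, s, rfl⟩
    exact ⟨_, mem_C.2 ⟨r, s, rfl⟩, by rw [add_mul_, smul_mul_, smul_mul_, one_mul_]⟩

theorem C_mul_mem {V : Submodule ℝ (A (n + 1))} (hV : ∀ v ∈ V, im n * v ∈ V) {α v : A (n + 1)}
    (hα : α ∈ C n) (hv : v ∈ V) : α * v ∈ V := by
  obtain ⟨r, s, rfl⟩ := mem_C.1 hα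
  rw [add_mul_, smul_mul_, smul_mul_, one_mul_]
  exact V.add_mem (V.smul_mem _ hv) (V.smul_mem _ (hV v hv))

theorem im_mul_mem_cSpan {v w : A (n + 1)} (hw : w ∈ cSpan v) : im n * w ∈ cSpan v := by
  obtain ⟨r, s, rfl⟩ := mem_cSpan_iff.1 hw
  refine mem_cSpan_iff.2 ⟨-s, r, ?_⟩
  rw [mul_add_, mul_smul_, mul_smul_, im_mul_im_mul]
  module

theorem finrank_cSpan {v : A (n + 1)} (hv : v ≠ 0) : Module.finrank ℝ (cSpan v) = 2 := by
  have hs : cSpan v = Submodule.span ℝ (Set.range ![v, im n * v]) := by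
    ext w
    rw [mem_cSpan_iff, Matrix.range_cons_cons_empty, Submodule.mem_span_pair]
  rw [hs, finrank_span_eq_card, Fintype.card_fin]
  rw [LinearIndependent.pair_iff]
  intro r s h
  have h1 := congrArg (inner ℝ v) h
  have h2 := congrArg (inner ℝ (im n * v)) h
  rw [inner_add_right, inner_smul_right, inner_smul_right, inner_zero_right] at h1 h2
  rw [real_inner_comm (im n * v) v, inner_im_mul_self] at h1
  rw [inner_im_mul_self, inner_im_mul_im_mul] at h2
  exact ⟨by simpa [hv] using h1, by simpa [hv] using h2⟩

end ComplexStructure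

/-! ### The product of a bracket with a general element. -/

section Bracket

variable {n : ℕ}

theorem im_mul_mul_im_mul {p q : A (n + 1)} (hp : p ∈ (C n)ᗮ) (hq : q ∈ (C n)ᗮ) :
    (im n * p) * (im n * q) = q * p - (2 * inner ℝ p (im n * q)) • im n := by
  rw [mul_im_mul (im_mul_mem hp) hq, im_mul_mul hp hq, mul_add_, im_mul_im_mul, mul_smul_, mul_one_]
  module

theorem im_mul_eq_zero {x : A (n + 1)} (h : im n * x = 0) : x = 0 := by
  have := im_mul_im_mul x
  rw [h, mul_zero_] at this
  exact neg_eq_zero.1 this.symm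

theorem sqrt_two_inv_mul_self : (1 / √2 : ℝ) * (1 / √2) = 1 / 2 := by
  rw [div_mul_div_comm, one_mul, Real.mul_self_sqrt (by norm_num)]

theorem bracket_mul_bracket {a b x y : A (n + 1)} (ha : a ∈ (C n)ᗮ) (hb : b ∈ (C n)ᗮ)
    (hx : x ∈ (C n)ᗮ) (hy : y ∈ (C n)ᗮ) :
    bracket a b * bracket x y =
      mk (a * x + b * y + (inner ℝ b (im n * y) - inner ℝ a (im n * y) - inner ℝ b (im n * x)
          + inner ℝ a (im n * x)) • im n)
        (im n * (b * y - a * x + (inner ℝ b x + inner ℝ b y - inner ℝ a x - inner ℝ a y) • 1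
          + (2 * (inner ℝ b (im n * y) - inner ℝ a (im n * x))) • im n)) := by
  have hs := add_mem ha hb
  have hd := add_mem (neg_mem ha) hb
  have hs' := add_mem hx hy
  have hd' := add_mem (neg_mem hx) hy
  have e1 : inner ℝ (-x + y) (im n * (-a + b)) = -(inner ℝ b (im n * y) - inner ℝ a (im n * y)
      - inner ℝ b (im n * x) + inner ℝ a (im n * x)) := by
    rw [real_inner_comm, inner_im_mul_left]
    simp only [mul_add_, mul_neg_, inner_add_left, inner_add_right, inner_neg_left, inner_neg_right]
    ring
  have e2 : inner ℝ (-x + y) (im n * (a + b)) = -(inner ℝ a (im n * y) + inner ℝ b (im n * y)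
      - inner ℝ a (im n * x) - inner ℝ b (im n * x)) := by
    rw [real_inner_comm, inner_im_mul_left]
    simp only [mul_add_, mul_neg_, inner_add_left, inner_add_right, inner_neg_right]
    ring
  have e3 : inner ℝ (-a + b) (im n * (x + y)) = -inner ℝ a (im n * x) - inner ℝ a (im n * y)
      + inner ℝ b (im n * x) + inner ℝ b (im n * y) := by
    simp only [mul_add_, inner_add_left, inner_add_right, inner_neg_left]
    ring
  have e4 : inner ℝ (-a + b) (x + y) = inner ℝ b x + inner ℝ b y - inner ℝ a x - inner ℝ a y := by
    simp only [inner_add_left, inner_add_right, inner_neg_left]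
    ring
  rw [bracket, bracket, smul_mul_, mul_smul_, smul_smul, sqrt_two_inv_mul_self, mk_mul_mk,
    star_of_mem (im_mul_mem hd'), star_of_mem hs', neg_mul_, mul_neg_,
    im_mul_mul_im_mul hd' hd, im_mul_mul hd' hs, im_mul_mul hd hs', mul_swap hd hs', smul_mk, mk_inj,
    e1, e2, e3, e4]
  constructor
  · simp only [mul_add_, add_mul_, mul_neg_, neg_mul_]
    module
  · simp only [mul_add_, add_mul_, mul_neg_, neg_mul_, mul_sub_, mul_smul_, im_mul_im, mul_one_]
    module

/-- The factor `√2` cancels the normalization `1 / √2` of `bracket`. -/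
theorem bracket_mul_quaternion {a b : A (n + 1)} (ha : a ∈ (C n)ᗮ) (hb : b ∈ (C n)ᗮ)
    (r₀ r₁ s₀ s₁ : ℝ) :
    bracket a b * (√2 • mk (r₀ • 1 + r₁ • im n) (s₀ • 1 + s₁ • im n)) =
      mk (r₀ • (a + b) - r₁ • (im n * (a + b)) - s₀ • (im n * (b - a)) - s₁ • (b - a))
        (im n * (s₁ • (a + b) - s₀ • (im n * (a + b)) + r₁ • (im n * (b - a)) + r₀ • (b - a))) := by
  have hd := add_mem (neg_mem ha) hb
  rw [bracket, smul_mul_, mul_smul_, smul_smul, one_div, inv_mul_cancel₀ (by positivity), one_smul,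
    mk_mul_mk, mk_inj]
  simp only [star_add_, star_smul_, star_one_, star_im, mul_add_, mul_sub_, add_mul_, mul_smul_,
    smul_mul_, mul_neg_, neg_mul_, mul_one_, one_mul_, im_mul_im_mul, mul_im ha, mul_im hb,
    mul_im (im_mul_mem ha), mul_im (im_mul_mem hb)]
  constructor <;> module

/-- By `inner_mul_one` and `inner_mul_im`, `a * x + inner ℝ a x • 1 + inner ℝ a (im n * x) • im n`
is the projection of `a * x` to `(C n)ᗮ`. The first two equations are therefore the `(C n)ᗮ` part of
the vanishing product, and the four scalar ones its `C n` part. -/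
theorem bracket_mul_eq_zero_iff {a b x y : A (n + 1)} (ha : a ∈ (C n)ᗮ) (hb : b ∈ (C n)ᗮ)
    (hx : x ∈ (C n)ᗮ) (hy : y ∈ (C n)ᗮ) (r₀ r₁ s₀ s₁ : ℝ) :
    bracket a b * (bracket x y + √2 • mk (r₀ • 1 + r₁ • im n) (s₀ • 1 + s₁ • im n)) = 0 ↔
      (a * x + inner ℝ a x • 1 + inner ℝ a (im n * x) • im n =
        -(r₀ • a) - s₀ • (im n * a) + s₁ • b + r₁ • (im n * b) ∧
      b * y + inner ℝ b y • 1 + inner ℝ b (im n * y) • im n =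
        -(r₀ • b) + s₀ • (im n * b) - s₁ • a + r₁ • (im n * a)) ∧
      (inner ℝ a x = -inner ℝ b y ∧ inner ℝ a (im n * x) = inner ℝ b (im n * y)) ∧
      inner ℝ a y = inner ℝ b x ∧ inner ℝ a (im n * y) = -inner ℝ b (im n * x) := by
  rw [mul_add_, bracket_mul_bracket ha hb hx hy, bracket_mul_quaternion ha hb, mk_add, ← mul_add_,
    zero_eq_mk, mk_inj]
  have a1 := (mem_C_orthogonal.1 ha).1
  have a2 := (mem_C_orthogonal.1 ha).2
  have b1 := (mem_C_orthogonal.1 hb).1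
  have b2 := (mem_C_orthogonal.1 hb).2
  have a3 := (mem_C_orthogonal.1 (im_mul_mem ha)).1
  have a4 := (mem_C_orthogonal.1 (im_mul_mem ha)).2
  have b3 := (mem_C_orthogonal.1 (im_mul_mem hb)).1
  have b4 := (mem_C_orthogonal.1 (im_mul_mem hb)).2
  constructor
  · rintro ⟨hF, hG⟩
    replace hG := im_mul_eq_zero hG
    -- Pairing with `1` and `im n` isolates the `C n` part; half the difference and half the sum of
    -- the two components then separate the equations for `a * x` and `b * y`.
    have f1 := congrArg (inner ℝ · 1) hF
    have f2 := congrArg (inner ℝ · (im n)) hF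
    have g1 := congrArg (inner ℝ · 1) hG
    have g2 := congrArg (inner ℝ · (im n)) hG
    simp only [inner_add_left, inner_sub_left, inner_smul_left, inner_zero_left, mul_add_, mul_sub_,
      inner_mul_one ha, inner_mul_one hb, inner_mul_im ha, inner_mul_im hb, a1, a2, a3, a4, b1, b2,
      b3, b4, inner_one_one, inner_im_one, inner_one_im, inner_im_im, RCLike.conj_to_real]
      at f1 f2 g1 g2
    have k1 : inner ℝ a x = -inner ℝ b y := by linarith
    have k2 : inner ℝ a (im n * x) = inner ℝ b (im n * y) := by linarith
    have k3 : inner ℝ a y = inner ℝ b x := by linarith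
    have k4 : inner ℝ a (im n * y) = -inner ℝ b (im n * x) := by linarith
    refine ⟨⟨?_, ?_⟩, ⟨k1, k2⟩, k3, k4⟩ <;>
      simp only [k1, k2, k3, k4, mul_add_, mul_sub_] at hF hG ⊢
    · linear_combination (norm := module) (1 / 2 : ℝ) • hF - (1 / 2 : ℝ) • hG
    · linear_combination (norm := module) (1 / 2 : ℝ) • hF + (1 / 2 : ℝ) • hG
  · rintro ⟨⟨hF, hG⟩, ⟨k1, k2⟩, k3, k4⟩
    rw [k1, k2] at hF
    constructor
    · simp only [k2, k4, mul_add_, mul_sub_]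
      linear_combination (norm := module) hF + hG
    · rw [← mul_zero_ (im n)]
      congr 1
      simp only [k1, k2, k3, mul_add_, mul_sub_]
      linear_combination (norm := module) hG - hF

end Bracket

/-! ### Bracket coordinates on `A (n + 2)` and existence of quotients. -/

section Decomposition

variable {n : ℕ}

theorem inner_bracket (x y x' y' : A (n + 1)) :
    inner ℝ (bracket x y) (bracket x' y') = inner ℝ x x' + inner ℝ y y' := by
  rw [bracket, bracket, inner_smul_left, inner_smul_right, RCLike.conj_to_real, ← mul_assoc,
    sqrt_two_inv_mul_self, inner_mk, inner_im_mul_im_mul]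
  simp only [inner_add_left, inner_add_right, inner_neg_left, inner_neg_right]
  ring

theorem bracket_add (x y x' y' : A (n + 1)) :
    bracket x y + bracket x' y' = bracket (x + x') (y + y') :=
  ((bracketₗ n).map_add (x, y) (x', y')).symm

theorem smul_bracket (r : ℝ) (x y : A (n + 1)) : r • bracket x y = bracket (r • x) (r • y) :=
  ((bracketₗ n).map_smul r (x, y)).symm

theorem bracket_sub (x y x' y' : A (n + 1)) :
    bracket x y - bracket x' y' = bracket (x - x') (y - y') :=
  ((bracketₗ n).map_sub (x, y) (x', y')).symm

theorem bracket_eq_zero {x y : A (n + 1)} (h : bracket x y = 0) : x = 0 ∧ y = 0 := by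
  have h1 := inner_bracket x y x y
  rw [h, inner_zero_left, real_inner_self_eq_norm_sq, real_inner_self_eq_norm_sq] at h1
  constructor
  · have : ‖x‖ ^ 2 = 0 := by nlinarith [sq_nonneg ‖x‖, sq_nonneg ‖y‖]
    simpa using this
  · have : ‖y‖ ^ 2 = 0 := by nlinarith [sq_nonneg ‖x‖, sq_nonneg ‖y‖]
    simpa using this

theorem bracketₗ_injective : Function.Injective (bracketₗ n) := by
  rw [← LinearMap.ker_eq_bot, LinearMap.ker_eq_bot']
  rintro ⟨x, y⟩ h
  obtain ⟨rfl, rfl⟩ := bracket_eq_zero h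
  rfl

theorem bracket_mem_H_orthogonal {x y : A (n + 1)} (hx : x ∈ (C n)ᗮ) (hy : y ∈ (C n)ᗮ) :
    bracket x y ∈ (H n)ᗮ := by
  have hs := mem_C_orthogonal.1 (add_mem hx hy)
  have hd := mem_C_orthogonal.1 (im_mul_mem (add_mem (neg_mem hx) hy))
  rw [bracket]
  refine Submodule.smul_mem _ _ ((Submodule.mem_orthogonal' _ _).2 fun u hu => ?_)
  induction hu using Submodule.span_induction with
  | mem u hu =>
    rcases hu with rfl | rfl | rfl | rfl <;> simp [inner_mk, hs.1, hs.2, hd.1, hd.2]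
  | zero => exact inner_zero_right _
  | add u v _ _ hu hv => rw [inner_add_right, hu, hv, add_zero]
  | smul r u _ hu => rw [inner_smul_right, hu, mul_zero]

theorem bracket_mem {x y : A (n + 1)} (hx : x ∈ (C n)ᗮ) (hy : y ∈ (C n)ᗮ) :
    bracket x y ∈ (C (n + 1))ᗮ := by
  have h := (Submodule.mem_orthogonal' _ _).1 (bracket_mem_H_orthogonal hx hy)
  exact mem_C_orthogonal.2 ⟨h _ (Submodule.subset_span (by simp [one_eq_mk (n := n + 1)])),
    h _ (Submodule.subset_span (by simp [im]))⟩

theorem inner_bracket_mk {x y p q : A (n + 1)} (hx : x ∈ (C n)ᗮ) (hy : y ∈ (C n)ᗮ)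
    (hp : p ∈ C n) (hq : q ∈ C n) : inner ℝ (bracket x y) (mk p q) = 0 := by
  have hs := (Submodule.mem_orthogonal' _ _).1 (add_mem hx hy)
  have hd := (Submodule.mem_orthogonal' _ _).1 (im_mul_mem (add_mem (neg_mem hx) hy))
  rw [bracket, inner_smul_left, inner_mk, hs p hp, hd q hq]
  simp

/-- The complex structure of `A (n + 2)` acts conjugately on the first slot; this explains the
opposite signs of the imaginary terms in `smul_diagonal_add` and `smul_skew_add`. -/
theorem im_mul_bracket {x y : A (n + 1)} (hx : x ∈ (C n)ᗮ) (hy : y ∈ (C n)ᗮ) :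
    im (n + 1) * bracket x y = bracket (-(im n * x)) (im n * y) := by
  rw [bracket, bracket, mul_smul_, im_mul_mk, star_of_mem (add_mem hx hy),
    star_of_mem (im_mul_mem (add_mem (neg_mem hx) hy))]
  congr 2
  · simp only [mul_add_, mul_neg_]; abel
  · simp only [mul_add_, im_mul_im_mul, neg_neg]; abel

theorem im_mul_mk_zero_im : im (n + 1) * mk 0 (im n) = mk (im n) 0 := by
  rw [im_mul_mk, star_im, star_zero_, neg_neg]

theorem exists_mem_C_add (c : A (n + 1)) :
    ∃ c' ∈ (C n)ᗮ, ∃ r s : ℝ, c = c' + (r • 1 + s • im n) := by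
  refine ⟨c - (inner ℝ c 1 • 1 + inner ℝ c (im n) • im n), mem_C_orthogonal.2 ⟨?_, ?_⟩,
    inner ℝ c 1, inner ℝ c (im n), by module⟩ <;>
  simp only [inner_sub_left, inner_add_left, inner_smul_left, inner_one_one, inner_one_im,
    inner_im_one, inner_im_im, RCLike.conj_to_real] <;>
  ring

theorem exists_bracket_add (z : A (n + 2)) :
    ∃ x ∈ (C n)ᗮ, ∃ y ∈ (C n)ᗮ, ∃ r₀ r₁ s₀ s₁ : ℝ,
      z = bracket x y + √2 • mk (r₀ • 1 + r₁ • im n) (s₀ • 1 + s₁ • im n) := by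
  obtain ⟨c, d, rfl⟩ := mk_eta z
  obtain ⟨c, hc, r₀, r₁, rfl⟩ := exists_mem_C_add c
  obtain ⟨d, hd, s₀, s₁, rfl⟩ := exists_mem_C_add d
  have h2 : (√2)⁻¹ * √2 = 1 := inv_mul_cancel₀ (by positivity)
  have h2' : √2 * (√2)⁻¹ = 1 := mul_inv_cancel₀ (by positivity)
  -- Solution of `x + y = √2 c` and `im n * (-x + y) = √2 d`.
  refine ⟨(√2 / 2) • (c + im n * d), Submodule.smul_mem _ _ (add_mem hc (im_mul_mem hd)),
    (√2 / 2) • (c - im n * d), Submodule.smul_mem _ _ (sub_mem hc (im_mul_mem hd)),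
    (√2)⁻¹ * r₀, (√2)⁻¹ * r₁, (√2)⁻¹ * s₀, (√2)⁻¹ * s₁, ?_⟩
  rw [bracket, smul_mk, smul_mk, mk_add, mk_inj]
  simp only [mul_add_, mul_sub_, mul_neg_, mul_smul_, im_mul_im_mul, smul_add, smul_sub, smul_neg,
    smul_smul, ← mul_assoc, h2', one_mul, one_div, mul_div_assoc', h2]
  constructor <;> module

theorem bracket_mem_DLocus_iff {a b : A (n + 1)} (ha : a ∈ (C n)ᗮ) (hb : b ∈ (C n)ᗮ) :
    bracket a b ∈ DLocus n ↔ herm a b = 0 ∧ a ∈ (Ann b)ᗮ ∧ b ∈ (Ann a)ᗮ := by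
  constructor
  · rintro ⟨a', -, b', -, h, h'⟩
    have := bracketₗ_injective (a₁ := (a, b)) (a₂ := (a', b')) h
    simp only [Prod.mk.injEq] at this
    rwa [this.1, this.2]
  · exact fun h => ⟨a, ha, b, hb, rfl, h⟩

/-- Left multiplication by `a` is skew-adjoint, so its range is the orthogonal complement of its
kernel. A preimage of `b` is then normalized by removing its `Ann a` component. -/
theorem existsUnique_isQuotient {a b : A (n + 1)} (ha : a ∈ (C n)ᗮ) (hb : b ∈ (Ann a)ᗮ) :
    ∃! q, IsQuotient b a q := by
  have hadj : mulₗ (n + 1) (-a) = LinearMap.adjoint (mulₗ (n + 1) a) := by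
    rw [LinearMap.eq_adjoint_iff]
    intro x y
    change inner ℝ (-a * x) y = inner ℝ x (a * y)
    rw [neg_mul_, inner_neg_left, inner_mul_of_mem ha, neg_neg]
  have hb' := hb
  rw [Ann, LinearMap.orthogonal_ker, ← hadj] at hb'
  obtain ⟨x, hx⟩ := hb'
  replace hx : a * -x = b := by rw [mul_neg_, ← neg_mul_]; exact hx
  obtain ⟨u, hu, q, hq, hxq⟩ := (Ann a).exists_add_mem_mem_orthogonal (-x)
  refine ⟨q, ⟨?_, hq⟩, ?_⟩
  · rw [← hx, hxq, mul_add_, mem_Ann.1 hu, zero_add]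
  · rintro q' ⟨h1, h2⟩
    have h3 : q' - q ∈ Ann a := by
      rw [mem_Ann, mul_sub_, h1, ← hx, hxq, mul_add_, mem_Ann.1 hu, zero_add, sub_self]
    have h4 := (Submodule.mem_orthogonal _ _).1 (sub_mem h2 hq) _ h3
    exact sub_eq_zero.1 (inner_self_eq_zero.1 h4)

end Decomposition

/-! ### The quaternion part of an annihilator element. -/

section Annihilator

variable {n : ℕ} {a b : A (n + 1)}

theorem inner_of_mem_Ann {u : A (n + 1)} (ha : a ∈ (C n)ᗮ) (hu : u ∈ Ann a) :
    inner ℝ a u = 0 ∧ inner ℝ a (im n * u) = 0 := by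
  have h1 := inner_mul_one (x := u) ha
  have h2 := inner_mul_im (x := u) ha
  rw [mem_Ann.1 hu, inner_zero_left] at h1 h2
  exact ⟨by linarith, by linarith⟩

/-- If `β b` is congruent modulo `ℂ` to an element of the image of `a`, for some nonzero
`β ∈ ℂ`, then `b` is orthogonal to the annihilator of `a`. -/
theorem mem_Ann_orthogonal_of_mul_eq {x : A (n + 1)} (ha : a ∈ (C n)ᗮ) (ha0 : a ≠ 0)
    {r s t₁ t₂ : ℝ} (hrs : r ^ 2 + s ^ 2 ≠ 0)
    (h : a * x + t₁ • 1 + t₂ • im n = r • b + s • (im n * b)) : b ∈ (Ann a)ᗮ := by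
  have key : ∀ u ∈ Ann a, r * inner ℝ b u + s * inner ℝ (im n * b) u = 0 := by
    intro u hu
    have h1 := congrArg (inner ℝ · u) h
    obtain ⟨h2, h3⟩ := mem_C_orthogonal.1 (Ann_le ha ha0 hu)
    rw [real_inner_comm] at h2 h3
    simp only [inner_add_left, inner_smul_left, inner_mul_of_mem ha, mem_Ann.1 hu, inner_zero_right,
      h2, h3, RCLike.conj_to_real] at h1
    linarith
  refine (Submodule.mem_orthogonal' _ _).2 fun u hu => ?_
  have h1 := key u hu
  have h2 := key _ (im_mul_mem_Ann ha ha0 hu)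
  rw [inner_im_mul_im_mul] at h2
  rw [inner_im_mul_left] at h1
  have : (r ^ 2 + s ^ 2) * inner ℝ b u = 0 := by linear_combination r * h1 + s * h2
  exact (mul_eq_zero.1 this).resolve_left hrs

/-- The product `a * x` is orthogonal to `a` and `im n * a`, and likewise for `b * y`, so pairing
leaves only norms and the Hermitian product of `a` and `b`. Combining the pairings for `a` and `b`
cancels the Hermitian terms and kills `r₀` and `s₀`. -/
theorem quaternion_part_of_mem_Ann {x y : A (n + 1)} (ha : a ∈ (C n)ᗮ) (hb : b ∈ (C n)ᗮ)
    (ha0 : a ≠ 0) (hb0 : b ≠ 0) (hx : x ∈ (C n)ᗮ) (hy : y ∈ (C n)ᗮ) {r₀ r₁ s₀ s₁ : ℝ}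
    (h : bracket x y + √2 • mk (r₀ • 1 + r₁ • im n) (s₀ • 1 + s₁ • im n) ∈ Ann (bracket a b)) :
    (r₀ = 0 ∧ s₀ = 0) ∧ (bracket a b ∉ DLocus n → r₁ = 0 ∧ s₁ = 0) := by
  rw [mem_Ann, bracket_mul_eq_zero_iff ha hb hx hy] at h
  obtain ⟨⟨h1, h2⟩, -⟩ := h
  have c1 : inner ℝ (im n * a) b = -inner ℝ a (im n * b) := inner_im_mul_left a b
  have c2 : inner ℝ b (im n * a) = -inner ℝ a (im n * b) := by rw [real_inner_comm, c1]
  have c3 : inner ℝ (im n * b) a = inner ℝ a (im n * b) := real_inner_comm _ _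
  have c4 : inner ℝ b a = inner ℝ a b := real_inner_comm _ _
  have p1 := congrArg (inner ℝ · a) h1
  have p2 := congrArg (inner ℝ · (im n * a)) h1
  have q1 := congrArg (inner ℝ · b) h2
  have q2 := congrArg (inner ℝ · (im n * b)) h2
  have z : ∀ p ∈ (C n)ᗮ, inner ℝ 1 p = 0 ∧ inner ℝ (im n) p = 0 := fun p hp => by
    rw [real_inner_comm, real_inner_comm p]; exact mem_C_orthogonal.1 hp
  simp only [inner_add_left, inner_sub_left, inner_neg_left, inner_smul_left, RCLike.conj_to_real,
    inner_mul_self_right ha hx, inner_mul_self_right hb hy, inner_mul_im_mul_self ha hx,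
    inner_mul_im_mul_self hb hy, (z a ha).1, (z a ha).2, (z b hb).1, (z b hb).2,
    (z _ (im_mul_mem ha)).1, (z _ (im_mul_mem ha)).2, (z _ (im_mul_mem hb)).1,
    (z _ (im_mul_mem hb)).2, inner_im_mul_im_mul, inner_im_mul_self,
    real_inner_comm (im n * a) a, real_inner_comm (im n * b) b,
    real_inner_self_eq_norm_sq, norm_im_mul, c1, c2, c3, c4] at p1 p2 q1 q2
  have hr : r₀ = 0 := by
    have : r₀ * (‖a‖ ^ 2 + ‖b‖ ^ 2) = 0 := by linarith
    exact (mul_eq_zero.1 this).resolve_right (by positivity)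
  have hs : s₀ = 0 := by
    have : s₀ * (‖a‖ ^ 2 + ‖b‖ ^ 2) = 0 := by linarith
    exact (mul_eq_zero.1 this).resolve_right (by positivity)
  subst hr hs
  refine ⟨⟨rfl, rfl⟩, fun hD => ?_⟩
  by_contra hne
  -- The remaining pairings are a linear system in the Hermitian product with determinant `±(s₁ ^ 2
  -- + r₁ ^ 2)`, and the vector equations now put a nonzero complex multiple of `b` in the image of
  -- `a` modulo `C n`, and vice versa.
  have hrs : s₁ ^ 2 + r₁ ^ 2 ≠ 0 := by
    intro h0
    exact hne ⟨by nlinarith [sq_nonneg s₁, sq_nonneg r₁], by nlinarith [sq_nonneg s₁, sq_nonneg r₁]⟩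
  refine hD ((bracket_mem_DLocus_iff ha hb).2 ⟨herm_eq_zero_iff.2 ⟨?_, ?_⟩, ?_, ?_⟩)
  · refine (mul_eq_zero.1 (?_ : (s₁ ^ 2 + r₁ ^ 2) * inner ℝ a b = 0)).resolve_left hrs
    linear_combination (-s₁) * p1 - r₁ * p2
  · refine (mul_eq_zero.1 (?_ : (s₁ ^ 2 + r₁ ^ 2) * inner ℝ a (im n * b) = 0)).resolve_left hrs
    linear_combination (-r₁) * p1 + s₁ * p2
  · refine mem_Ann_orthogonal_of_mul_eq hb hb0 (r := -s₁) (s := r₁) (by rwa [neg_sq])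
      (h2.trans ?_)
    module
  · refine mem_Ann_orthogonal_of_mul_eq ha ha0 hrs (h1.trans ?_)
    module

end Annihilator

/-! ### Annihilator elements without quaternion part, and the generic dimension. -/

section Parametrization

variable {n : ℕ} {a b : A (n + 1)}

theorem bracket_mem_Ann_iff {x y : A (n + 1)} (ha : a ∈ (C n)ᗮ) (hb : b ∈ (C n)ᗮ)
    (hx : x ∈ (C n)ᗮ) (hy : y ∈ (C n)ᗮ) :
    bracket x y ∈ Ann (bracket a b) ↔
      (a * x + inner ℝ a x • 1 + inner ℝ a (im n * x) • im n = 0 ∧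
      b * y + inner ℝ b y • 1 + inner ℝ b (im n * y) • im n = 0) ∧
      (inner ℝ a x = -inner ℝ b y ∧ inner ℝ a (im n * x) = inner ℝ b (im n * y)) ∧
      inner ℝ a y = inner ℝ b x ∧ inner ℝ a (im n * y) = -inner ℝ b (im n * x) := by
  have h := bracket_mul_eq_zero_iff ha hb hx hy 0 0 0 0
  simp only [zero_smul, add_zero, neg_zero, sub_zero, ← zero_eq_mk, smul_zero] at h
  rw [mem_Ann, h]

/-- The generator of the part of the annihilator of `{a, b}` spanned by multiples of `a` and `b`. -/
noncomputable def diagonal (a b : A (n + 1)) : A (n + 2) := bracket (‖b‖ ^ 2 • a) (-(‖a‖ ^ 2 • b))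

theorem smul_diagonal_add (ha : a ∈ (C n)ᗮ) (hb : b ∈ (C n)ᗮ) (s t : ℝ) :
    s • diagonal a b + t • (im (n + 1) * diagonal a b) =
      bracket (‖b‖ ^ 2 • (s • a - t • (im n * a))) (-(‖a‖ ^ 2 • (s • b + t • (im n * b)))) := by
  rw [diagonal, im_mul_bracket (Submodule.smul_mem _ _ ha) (neg_mem (Submodule.smul_mem _ _ hb)),
    smul_bracket, smul_bracket, bracket_add, mul_smul_, mul_neg_, mul_smul_]
  congr 1 <;> module

/-- The vector equations hold because `a * a` and `b * b` are real, and the weights in `diagonal`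
balance the first scalar pair: both sides have size `‖a‖² ‖b‖²`. Only the second pair remains. -/
theorem bracket_add_diagonal_mem_Ann_iff (ha : a ∈ (C n)ᗮ) (hb : b ∈ (C n)ᗮ) (ha0 : a ≠ 0)
    (hb0 : b ≠ 0) {u v : A (n + 1)} (hu : u ∈ Ann a) (hv : v ∈ Ann b) (s t : ℝ) :
    bracket u v + (s • diagonal a b + t • (im (n + 1) * diagonal a b)) ∈ Ann (bracket a b) ↔
      inner ℝ a v - inner ℝ b u -
        (‖a‖ ^ 2 + ‖b‖ ^ 2) * (s * inner ℝ a b + t * inner ℝ a (im n * b)) = 0 ∧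
      inner ℝ a (im n * v) + inner ℝ b (im n * u) -
        (‖a‖ ^ 2 + ‖b‖ ^ 2) * (s * inner ℝ a (im n * b) - t * inner ℝ a b) = 0 := by
  have hia := im_mul_mem ha
  have hib := im_mul_mem hb
  obtain ⟨u1, u2⟩ := inner_of_mem_Ann ha hu
  obtain ⟨v1, v2⟩ := inner_of_mem_Ann hb hv
  have c2 : inner ℝ b (im n * a) = -inner ℝ a (im n * b) := by
    rw [real_inner_comm, inner_im_mul_left]
  have c4 : inner ℝ b a = inner ℝ a b := real_inner_comm _ _
  have a1 : inner ℝ a (im n * a) = 0 := by rw [real_inner_comm, inner_im_mul_self]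
  have b1 : inner ℝ b (im n * b) = 0 := by rw [real_inner_comm, inner_im_mul_self]
  rw [smul_diagonal_add ha hb, bracket_add, bracket_mem_Ann_iff ha hb
    (add_mem (Ann_le ha ha0 hu) (Submodule.smul_mem _ _
      (sub_mem (Submodule.smul_mem _ _ ha) (Submodule.smul_mem _ _ hia))))
    (add_mem (Ann_le hb hb0 hv) (neg_mem (Submodule.smul_mem _ _
      (add_mem (Submodule.smul_mem _ _ hb) (Submodule.smul_mem _ _ hib)))))]
  simp only [mul_add_, mul_sub_, mul_neg_, mul_smul_, mul_im_mul ha ha, mul_im_mul hb hb,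
    mem_Ann.1 hu, mem_Ann.1 hv, mul_self_of_mem ha, mul_self_of_mem hb, mul_one_, im_mul_im_mul,
    inner_add_right, inner_sub_right, inner_neg_right, inner_smul_right, u1, u2, v1, v2, c2, c4,
    a1, b1, real_inner_self_eq_norm_sq]
  constructor
  · rintro ⟨-, -, h1, h2⟩
    constructor <;> linarith
  · rintro ⟨h1, h2⟩
    refine ⟨⟨?_, ?_⟩, ⟨?_, ?_⟩, ?_, ?_⟩
    · module
    · module
    · ring
    · ring
    · linarith
    · linarith

/-- Left multiplication by `a` carries the complex line of `a` onto `C n`, so a multiple of `a`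
corrects any `x` with `a * x` in `C n`. -/
theorem sub_mem_Ann {x : A (n + 1)} (ha : a ∈ (C n)ᗮ) (ha0 : a ≠ 0)
    (h : a * x + inner ℝ a x • 1 + inner ℝ a (im n * x) • im n = 0) :
    x - (inner ℝ a x / ‖a‖ ^ 2) • a + (inner ℝ a (im n * x) / ‖a‖ ^ 2) • (im n * a) ∈ Ann a := by
  have hn : ‖a‖ ^ 2 ≠ 0 := by positivity
  rw [mem_Ann, mul_add_, mul_sub_, mul_smul_, mul_smul_, mul_im_mul ha ha, mul_self_of_mem ha,
    mul_neg_, mul_smul_, mul_one_, neg_neg, smul_neg, smul_smul, smul_smul, div_mul_cancel₀ _ hn,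
    div_mul_cancel₀ _ hn, sub_neg_eq_add, h]

theorem exists_of_bracket_mem_Ann (ha : a ∈ (C n)ᗮ) (hb : b ∈ (C n)ᗮ) (ha0 : a ≠ 0)
    (hb0 : b ≠ 0) {x y : A (n + 1)} (hx : x ∈ (C n)ᗮ) (hy : y ∈ (C n)ᗮ)
    (h : bracket x y ∈ Ann (bracket a b)) :
    ∃ u ∈ Ann a, ∃ v ∈ Ann b, ∃ s t : ℝ,
      bracket x y = bracket u v + (s • diagonal a b + t • (im (n + 1) * diagonal a b)) := by
  obtain ⟨⟨h1, h2⟩, ⟨h3, h4⟩, -⟩ := (bracket_mem_Ann_iff ha hb hx hy).1 h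
  have hn : ‖a‖ ^ 2 ≠ 0 := by positivity
  have hm : ‖b‖ ^ 2 ≠ 0 := by positivity
  refine ⟨_, sub_mem_Ann ha ha0 h1, _, sub_mem_Ann hb hb0 h2,
    inner ℝ a x / (‖a‖ ^ 2 * ‖b‖ ^ 2), inner ℝ a (im n * x) / (‖a‖ ^ 2 * ‖b‖ ^ 2), ?_⟩
  have e (r : ℝ) : r / ‖a‖ ^ 2 = ‖b‖ ^ 2 * (r / (‖a‖ ^ 2 * ‖b‖ ^ 2)) := by field_simp
  have e' (r : ℝ) : r / ‖b‖ ^ 2 = ‖a‖ ^ 2 * (r / (‖a‖ ^ 2 * ‖b‖ ^ 2)) := by field_simp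
  have h3' : inner ℝ b y = -inner ℝ a x := by linarith
  rw [smul_diagonal_add ha hb, bracket_add, h3', ← h4, neg_div]
  simp only [e (inner ℝ a x), e (inner ℝ a (im n * x)), e' (inner ℝ a x),
    e' (inner ℝ a (im n * x))]
  congr 1 <;> module

/-- The parametrization `(u, v, s, t) ↦ {u, v} + (s + t i) {‖b‖² a, -‖a‖² b}`. -/
noncomputable def param (a b : A (n + 1)) : (Ann a × Ann b) × ℝ × ℝ →ₗ[ℝ] A (n + 2) :=
  (bracketₗ n ∘ₗ (Ann a).subtype.prodMap (Ann b).subtype).coprod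
    ((LinearMap.toSpanSingleton ℝ _ (diagonal a b)).coprod
      (LinearMap.toSpanSingleton ℝ _ (im (n + 1) * diagonal a b)))

theorem param_apply (u : Ann a) (v : Ann b) (s t : ℝ) :
    param a b ((u, v), s, t) =
      bracket (u : A (n + 1)) v + (s • diagonal a b + t • (im (n + 1) * diagonal a b)) := rfl

theorem param_injective (ha : a ∈ (C n)ᗮ) (hb : b ∈ (C n)ᗮ) (ha0 : a ≠ 0) (hb0 : b ≠ 0) :
    Function.Injective (param a b) := by
  rw [← LinearMap.ker_eq_bot, LinearMap.ker_eq_bot']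
  rintro ⟨⟨⟨u, hu⟩, ⟨v, hv⟩⟩, s, t⟩ h
  rw [param_apply, smul_diagonal_add ha hb, bracket_add] at h
  obtain ⟨h1, h2⟩ := bracket_eq_zero h
  obtain ⟨u1, u2⟩ := inner_of_mem_Ann ha hu
  have a1 : inner ℝ a (im n * a) = 0 := by rw [real_inner_comm, inner_im_mul_self]
  have hn : ‖a‖ ≠ 0 := by positivity
  have hm : ‖b‖ ≠ 0 := by positivity
  have hs := congrArg (inner ℝ a) h1
  have ht := congrArg (fun z => inner ℝ a (im n * z)) h1
  simp only [mul_add_, mul_sub_, mul_smul_, im_mul_im_mul, inner_add_right, inner_sub_right,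
    inner_neg_right, inner_smul_right, u1, u2, a1, inner_zero_right, mul_zero_,
    real_inner_self_eq_norm_sq] at hs ht
  have hs' : s = 0 := by simpa [hn, hm] using hs
  have ht' : t = 0 := by simpa [hn, hm] using ht
  subst hs' ht'
  simp only [zero_smul, sub_zero, add_zero, smul_zero, neg_zero] at h1 h2
  subst h1 h2
  rfl

/-- The obstruction for `param a b` to take values in the annihilator of `{a, b}`. -/
noncomputable def obstruction (a b : A (n + 1)) : (Ann a × Ann b) × ℝ × ℝ →ₗ[ℝ] ℝ × ℝ where
  toFun p :=
    (inner ℝ a (p.1.2 : A (n + 1)) - inner ℝ b (p.1.1 : A (n + 1)) -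
        (‖a‖ ^ 2 + ‖b‖ ^ 2) * (p.2.1 * inner ℝ a b + p.2.2 * inner ℝ a (im n * b)),
      inner ℝ a (im n * (p.1.2 : A (n + 1))) + inner ℝ b (im n * (p.1.1 : A (n + 1))) -
        (‖a‖ ^ 2 + ‖b‖ ^ 2) * (p.2.1 * inner ℝ a (im n * b) - p.2.2 * inner ℝ a b))
  map_add' p q := by
    simp only [Prod.fst_add, Prod.snd_add, Submodule.coe_add, mul_add_, inner_add_right,
      Prod.mk_add_mk, Prod.mk.injEq]
    constructor <;> ring
  map_smul' r p := by
    simp only [Prod.smul_fst, Prod.smul_snd, Submodule.coe_smul, mul_smul_, inner_smul_right,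
      Prod.smul_mk, smul_eq_mul, RingHom.id_apply, Prod.mk.injEq]
    constructor <;> ring

theorem param_mem_Ann_iff (ha : a ∈ (C n)ᗮ) (hb : b ∈ (C n)ᗮ) (ha0 : a ≠ 0) (hb0 : b ≠ 0)
    (p : (Ann a × Ann b) × ℝ × ℝ) :
    param a b p ∈ Ann (bracket a b) ↔ obstruction a b p = 0 := by
  obtain ⟨⟨⟨u, hu⟩, ⟨v, hv⟩⟩, s, t⟩ := p
  rw [param_apply, bracket_add_diagonal_mem_Ann_iff ha hb ha0 hb0 hu hv, Prod.ext_iff]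
  rfl

/-- The vectors `(p, q)` and `(q, -p)` are orthogonal of equal nonzero length. -/
theorem surjective_of_mem_range {M : Type*} [AddCommGroup M] [Module ℝ M] (f : M →ₗ[ℝ] ℝ × ℝ)
    {p q : ℝ} (hpq : p ≠ 0 ∨ q ≠ 0) (h1 : (p, q) ∈ LinearMap.range f)
    (h2 : (q, -p) ∈ LinearMap.range f) : Function.Surjective f := by
  have hN : p ^ 2 + q ^ 2 ≠ 0 := by
    rcases hpq with h | h <;> positivity
  rintro ⟨r, s⟩
  have := (LinearMap.range f).add_mem
    ((LinearMap.range f).smul_mem ((r * p + s * q) / (p ^ 2 + q ^ 2)) h1)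
    ((LinearMap.range f).smul_mem ((r * q - s * p) / (p ^ 2 + q ^ 2)) h2)
  have e : ((r, s) : ℝ × ℝ) = ((r * p + s * q) / (p ^ 2 + q ^ 2)) • (p, q) +
      ((r * q - s * p) / (p ^ 2 + q ^ 2)) • (q, -p) := by
    simp only [Prod.smul_mk, smul_eq_mul, Prod.mk_add_mk, Prod.mk.injEq]
    constructor <;> field_simp <;> ring
  rwa [← e] at this

/-- Each of the three D-locus conditions, when it fails, supplies a nonzero value: from some `u`,
some `v`, or the parameters `s, t`. The companion value `(q, -p)` comes from applying the complex
structure to that input. -/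
theorem obstruction_surjective (ha : a ∈ (C n)ᗮ) (hb : b ∈ (C n)ᗮ) (ha0 : a ≠ 0) (hb0 : b ≠ 0)
    (hD : bracket a b ∉ DLocus n) : Function.Surjective (obstruction a b) := by
  rw [bracket_mem_DLocus_iff ha hb, herm_eq_zero_iff] at hD
  have hN : ‖a‖ ^ 2 + ‖b‖ ^ 2 ≠ 0 := by positivity
  by_cases hH : inner ℝ a b = 0 ∧ inner ℝ a (im n * b) = 0
  · by_cases haV : a ∈ (Ann b)ᗮ
    · have hbU : b ∉ (Ann a)ᗮ := fun h => hD ⟨hH, haV, h⟩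
      rw [Submodule.mem_orthogonal'] at hbU
      push Not at hbU
      obtain ⟨u, hu, hne⟩ := hbU
      refine surjective_of_mem_range _ (p := -inner ℝ b u) (q := inner ℝ b (im n * u))
        (Or.inl (neg_ne_zero.2 hne)) ⟨((⟨u, hu⟩, 0), 0, 0), ?_⟩
        ⟨((⟨-(im n * u), neg_mem (im_mul_mem_Ann ha ha0 hu)⟩, 0), 0, 0), ?_⟩ <;>
      simp [obstruction, mul_zero_, mul_neg_, im_mul_im_mul]
    · rw [Submodule.mem_orthogonal'] at haV
      push Not at haV
      obtain ⟨v, hv, hne⟩ := haV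
      refine surjective_of_mem_range _ (p := inner ℝ a v) (q := inner ℝ a (im n * v))
        (Or.inl hne) ⟨((0, ⟨v, hv⟩), 0, 0), ?_⟩
        ⟨((0, ⟨im n * v, im_mul_mem_Ann hb hb0 hv⟩), 0, 0), ?_⟩ <;>
      simp [obstruction, mul_zero_, im_mul_im_mul]
  · refine surjective_of_mem_range _ (p := inner ℝ a b) (q := inner ℝ a (im n * b))
      (by tauto) ⟨(0, -(‖a‖ ^ 2 + ‖b‖ ^ 2)⁻¹, 0), ?_⟩ ⟨(0, 0, -(‖a‖ ^ 2 + ‖b‖ ^ 2)⁻¹), ?_⟩ <;>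
    simp [obstruction, mul_zero_, hN]

theorem exists_param_of_mem_Ann (ha : a ∈ (C n)ᗮ) (hb : b ∈ (C n)ᗮ) (ha0 : a ≠ 0) (hb0 : b ≠ 0)
    (hD : bracket a b ∉ DLocus n) {z : A (n + 2)} (hz : z ∈ Ann (bracket a b)) :
    ∃ x ∈ (C n)ᗮ, ∃ y ∈ (C n)ᗮ, z = bracket x y ∧ ∃ p, param a b p = z := by
  obtain ⟨x, hx, y, hy, r₀, r₁, s₀, s₁, rfl⟩ := exists_bracket_add z
  obtain ⟨⟨rfl, rfl⟩, h⟩ := quaternion_part_of_mem_Ann ha hb ha0 hb0 hx hy hz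
  obtain ⟨rfl, rfl⟩ := h hD
  simp only [zero_smul, add_zero, ← zero_eq_mk, smul_zero] at hz ⊢
  obtain ⟨u, hu, v, hv, s, t, h⟩ := exists_of_bracket_mem_Ann ha hb ha0 hb0 hx hy hz
  exact ⟨x, hx, y, hy, rfl, ((⟨u, hu⟩, ⟨v, hv⟩), s, t), h.symm⟩

theorem Ann_bracket_le_of_notMem (ha : a ∈ (C n)ᗮ) (hb : b ∈ (C n)ᗮ) (ha0 : a ≠ 0) (hb0 : b ≠ 0)
    (hD : bracket a b ∉ DLocus n) : Ann (bracket a b) ≤ (H n)ᗮ := by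
  intro z hz
  obtain ⟨x, hx, y, hy, rfl, -⟩ := exists_param_of_mem_Ann ha hb ha0 hb0 hD hz
  exact bracket_mem_H_orthogonal hx hy

/-- Rank-nullity: the two dimensions of `ℝ × ℝ` in the source of `obstruction` are offset by its
rank 2. -/
theorem finrank_Ann_bracket_of_notMem (ha : a ∈ (C n)ᗮ) (hb : b ∈ (C n)ᗮ) (ha0 : a ≠ 0)
    (hb0 : b ≠ 0) (hD : bracket a b ∉ DLocus n) :
    Module.finrank ℝ (Ann (bracket a b)) =
      Module.finrank ℝ (Ann a) + Module.finrank ℝ (Ann b) := by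
  have h1 : Ann (bracket a b) = (LinearMap.ker (obstruction a b)).map (param a b) := by
    ext z
    constructor
    · intro hz
      obtain ⟨x, -, y, -, -, p, rfl⟩ := exists_param_of_mem_Ann ha hb ha0 hb0 hD hz
      exact ⟨p, (param_mem_Ann_iff ha hb ha0 hb0 p).1 hz, rfl⟩
    · rintro ⟨p, hp, rfl⟩
      exact (param_mem_Ann_iff ha hb ha0 hb0 p).2 hp
  have h2 := LinearMap.finrank_range_add_finrank_ker (obstruction a b)
  have h3 : Module.finrank ℝ (LinearMap.range (obstruction a b)) = 2 := by
    rw [LinearMap.range_eq_top.2 (obstruction_surjective ha hb ha0 hb0 hD), finrank_top,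
      Module.finrank_prod, Module.finrank_self]
  simp only [Module.finrank_prod, Module.finrank_self] at h2
  rw [h1, ← (Submodule.equivMapOfInjective _ (param_injective ha hb ha0 hb0) _).finrank_eq]
  omega

end Parametrization

/-! ### The three summands on the D-locus. -/

section DirectSum

variable {n : ℕ} {a b : A (n + 1)}

theorem inner_eq_zero_of_mem_cSpan {U : Submodule ℝ (A (n + 1))} (hU : ∀ u ∈ U, im n * u ∈ U)
    {w : A (n + 1)} (h : ∀ u ∈ U, inner ℝ u w = 0) : ∀ u ∈ U, ∀ v ∈ cSpan w, inner ℝ u v = 0 := by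
  intro u hu v hv
  obtain ⟨r, s, rfl⟩ := mem_cSpan_iff.1 hv
  have := h _ (hU u hu)
  rw [inner_im_mul_left, neg_eq_zero] at this
  rw [inner_add_right, inner_smul_right, inner_smul_right, h u hu, this, mul_zero, mul_zero,
    add_zero]

theorem isCOrthogonalDirectSum_triple {V₁ V₂ V₃ : Submodule ℝ (A (n + 1))}
    (h₁ : ∀ v ∈ V₁, im n * v ∈ V₁) (h₂ : ∀ v ∈ V₂, im n * v ∈ V₂) (h₃ : ∀ v ∈ V₃, im n * v ∈ V₃)
    (h₁₂ : ∀ u ∈ V₁, ∀ v ∈ V₂, inner ℝ u v = 0) (h₁₃ : ∀ u ∈ V₁, ∀ v ∈ V₃, inner ℝ u v = 0)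
    (h₂₃ : ∀ u ∈ V₂, ∀ v ∈ V₃, inner ℝ u v = 0) :
    IsCOrthogonalDirectSum (V₁ ⊔ V₂ ⊔ V₃) ![V₁, V₂, V₃] := by
  have hm : ∀ i, ∀ v ∈ ![V₁, V₂, V₃] i, im n * v ∈ ![V₁, V₂, V₃] i := by
    intro i
    fin_cases i
    exacts [h₁, h₂, h₃]
  have ho : ∀ i j, i ≠ j → ∀ u ∈ ![V₁, V₂, V₃] i, ∀ v ∈ ![V₁, V₂, V₃] j, inner ℝ u v = 0 := by
    intro i j hij
    fin_cases i <;> fin_cases j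
    exacts [absurd rfl hij, h₁₂, h₁₃, fun u hu v hv => (real_inner_comm _ _).trans (h₁₂ v hv u hu),
      absurd rfl hij, h₂₃, fun u hu v hv => (real_inner_comm _ _).trans (h₁₃ v hv u hu),
      fun u hu v hv => (real_inner_comm _ _).trans (h₂₃ v hv u hu), absurd rfl hij]
  refine ⟨fun i α hα v hv => C_mul_mem (hm i) hα hv,
    fun i j hij u hu v hv => herm_eq_zero_of_forall (hm j) (ho i j hij) hu hv, ?_, ?_⟩
  · refine OrthogonalFamily.independent (𝕜 := ℝ) (V := ![V₁, V₂, V₃]) fun i j hij u v => ?_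
    exact ho i j hij u u.2 v v.2
  · refine le_antisymm (iSup_le fun i => ?_)
      (sup_le (sup_le (le_iSup ![V₁, V₂, V₃] 0) (le_iSup ![V₁, V₂, V₃] 1))
        (le_iSup ![V₁, V₂, V₃] 2))
    fin_cases i
    exacts [le_sup_of_le_left le_sup_left, le_sup_of_le_left le_sup_right, le_sup_right]

theorem finrank_sup_of_inner_eq_zero {U V : Submodule ℝ (A n)}
    (h : ∀ u ∈ U, ∀ v ∈ V, inner ℝ u v = 0) :
    Module.finrank ℝ (U ⊔ V : Submodule ℝ (A n)) = Module.finrank ℝ U + Module.finrank ℝ V := by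
  have hd : U ⊓ V = ⊥ := (Submodule.isOrtho_iff_inner_eq.2 h).disjoint.eq_bot
  have := Submodule.finrank_sup_add_finrank_inf_eq U V
  rwa [hd, finrank_bot, add_zero] at this

theorem finrank_bracketSpace (U V : Submodule ℝ (A (n + 1))) :
    Module.finrank ℝ (bracketSpace U V) = Module.finrank ℝ U + Module.finrank ℝ V := by
  have h : bracketSpace U V = LinearMap.range (bracketₗ n ∘ₗ U.subtype.prodMap V.subtype) := by
    ext z
    rw [mem_bracketSpace]
    constructor
    · rintro ⟨x, hx, y, hy, rfl⟩
      exact ⟨(⟨x, hx⟩, ⟨y, hy⟩), rfl⟩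
    · rintro ⟨⟨x, y⟩, rfl⟩
      exact ⟨x, x.2, y, y.2, rfl⟩
  rw [h, LinearMap.finrank_range_of_inj, Module.finrank_prod]
  exact bracketₗ_injective.comp (U.subtype_injective.prodMap V.subtype_injective)

theorem quotient_mem {q : A (n + 1)} (ha : a ∈ (C n)ᗮ) (ha0 : a ≠ 0) (h : herm a b = 0)
    (hq : a * q = b) : q ∈ (C n)ᗮ := by
  obtain ⟨h1, h2⟩ := herm_eq_zero_iff.1 h
  have hn : ‖a‖ ^ 2 ≠ 0 := by positivity
  have k1 := inner_mul_of_mem ha q a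
  have k2 := inner_mul_of_mem ha q (im n * a)
  rw [hq, mul_self_of_mem ha, inner_neg_right, inner_smul_right, neg_neg, real_inner_comm, h1] at k1
  rw [hq, mul_im_mul ha ha, mul_self_of_mem ha, mul_neg_, mul_smul_, mul_one_, neg_neg,
    inner_smul_right, real_inner_comm, inner_im_mul_left, h2, neg_zero] at k2
  exact mem_C_orthogonal.2 ⟨(mul_eq_zero.1 k1.symm).resolve_left hn,
    (mul_eq_zero.1 (neg_eq_zero.1 k2.symm)).resolve_left hn⟩

/-- Skew-adjointness gives `⟨b, q⟩ = ⟨a * q, q⟩ = 0`, and anticommutation with `im n` gives the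
analogue for `im n * q`. The pairings with `a` are, up to sign, those of `a * q = b` with `1` and
`im n`. -/
theorem inner_quotient {q : A (n + 1)} (ha : a ∈ (C n)ᗮ) (hb : b ∈ (C n)ᗮ)
    (hqC : q ∈ (C n)ᗮ) (hq : a * q = b) :
    (inner ℝ a q = 0 ∧ inner ℝ a (im n * q) = 0) ∧
      inner ℝ b q = 0 ∧ inner ℝ b (im n * q) = 0 := by
  obtain ⟨b1, b2⟩ := mem_C_orthogonal.1 hb
  have h1 := inner_mul_one (x := q) ha
  have h2 := inner_mul_im (x := q) ha
  have h3 := inner_mul_of_mem ha q q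
  have h4 := inner_mul_of_mem ha q (im n * q)
  rw [hq] at h1 h2 h3
  have h5 : inner ℝ b (im n * q) = -inner ℝ q (im n * b) := by
    rw [real_inner_comm, inner_im_mul_left]
  rw [mul_im_mul ha hqC, hq, inner_neg_right, neg_neg] at h4
  rw [real_inner_comm b q] at h3
  refine ⟨⟨by linarith, by linarith⟩, by linarith, by linarith⟩

/-- The annihilator element `{p, -q} + √2 (0, i)`, where `p = b / a` and `q = a / b`. -/
noncomputable def skew (p q : A (n + 1)) : A (n + 2) := bracket p (-q) + √2 • mk 0 (im n)

theorem smul_skew_add {p q : A (n + 1)} (hp : p ∈ (C n)ᗮ) (hq : q ∈ (C n)ᗮ) (r s : ℝ) :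
    s • skew p q + r • (im (n + 1) * skew p q) =
      bracket (s • p - r • (im n * p)) (-(s • q + r • (im n * q))) +
        √2 • mk (r • im n) (s • im n) := by
  have h : mk (r • im n) (s • im n) = s • mk 0 (im n) + r • mk (im n) 0 := by
    rw [smul_mk, smul_mk, mk_add, smul_zero, smul_zero, zero_add, add_zero]
  have h' : bracket (s • p - r • (im n * p)) (-(s • q + r • (im n * q))) =
      s • bracket p (-q) + r • bracket (-(im n * p)) (im n * -q) := by
    rw [smul_bracket, smul_bracket, bracket_add, mul_neg_]
    congr 1 <;> module
  rw [h, h', skew, mul_add_, mul_smul_, im_mul_mk_zero_im, im_mul_bracket hp (neg_mem hq)]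
  module

theorem skew_ne_zero {p q : A (n + 1)} (hp : p ∈ (C n)ᗮ) (hq : q ∈ (C n)ᗮ) : skew p q ≠ 0 := by
  intro h
  have hi : im n ∈ C n := mem_C.2 ⟨0, 1, by module⟩
  have := congrArg (inner ℝ · (mk 0 (im n))) h
  simp only [skew, inner_add_left, inner_bracket_mk hp (neg_mem hq) (zero_mem _) hi,
    inner_smul_left, inner_mk, inner_im_im, inner_zero_left, RCLike.conj_to_real] at this
  simp at this

theorem diagonal_ne_zero (ha0 : a ≠ 0) (hb0 : b ≠ 0) : diagonal a b ≠ 0 := by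
  intro h
  have := (bracket_eq_zero h).1
  simp [ha0, hb0] at this

theorem inner_bracket_skew {p q x y : A (n + 1)} (hx : x ∈ (C n)ᗮ) (hy : y ∈ (C n)ᗮ) :
    inner ℝ (bracket x y) (skew p q) = inner ℝ x p - inner ℝ y q := by
  have hi : im n ∈ C n := mem_C.2 ⟨0, 1, by module⟩
  rw [skew, inner_add_right, inner_bracket, inner_smul_right,
    inner_bracket_mk hx hy (zero_mem _) hi, inner_neg_right]
  ring

theorem cSpan_le_Ann {z w : A (n + 1)} (hz : z ∈ (C n)ᗮ) (hz0 : z ≠ 0) (hw : w ∈ Ann z) :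
    cSpan w ≤ Ann z := by
  intro v hv
  obtain ⟨r, s, rfl⟩ := mem_cSpan_iff.1 hv
  exact add_mem (Submodule.smul_mem _ _ hw) (Submodule.smul_mem _ _ (im_mul_mem_Ann hz hz0 hw))

theorem diagonal_mem_Ann (ha : a ∈ (C n)ᗮ) (hb : b ∈ (C n)ᗮ) (ha0 : a ≠ 0) (hb0 : b ≠ 0)
    (h : herm a b = 0) : diagonal a b ∈ Ann (bracket a b) := by
  obtain ⟨h1, h2⟩ := herm_eq_zero_iff.1 h
  have := (bracket_add_diagonal_mem_Ann_iff ha hb ha0 hb0 (zero_mem _) (zero_mem _) 1 0).2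
    (by simp [mul_zero_, h1, h2])
  have h0 : bracket (0 : A (n + 1)) 0 = 0 := (bracketₗ n).map_zero
  rwa [h0, zero_add, one_smul, zero_smul, add_zero] at this

theorem bracketSpace_le_Ann (ha : a ∈ (C n)ᗮ) (hb : b ∈ (C n)ᗮ) (ha0 : a ≠ 0) (hb0 : b ≠ 0)
    (haV : a ∈ (Ann b)ᗮ) (hbU : b ∈ (Ann a)ᗮ) :
    bracketSpace (Ann a) (Ann b) ≤ Ann (bracket a b) := by
  intro z hz
  obtain ⟨u, hu, v, hv, rfl⟩ := mem_bracketSpace.1 hz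
  rw [Submodule.mem_orthogonal'] at haV hbU
  have := (bracket_add_diagonal_mem_Ann_iff ha hb ha0 hb0 hu hv 0 0).2
    (by simp [haV v hv, hbU u hu, haV _ (im_mul_mem_Ann hb hb0 hv),
      hbU _ (im_mul_mem_Ann ha ha0 hu)])
  rwa [zero_smul, zero_smul, add_zero, add_zero] at this

/-- This is the solution with `s₁ = 1` and the other quaternion coefficients zero: the equations
read `a * x = b` and `b * y = -a`, whence the sign of `-q`; all the scalar pairings vanish. -/
theorem skew_mem_Ann {p q : A (n + 1)} (ha : a ∈ (C n)ᗮ) (hb : b ∈ (C n)ᗮ)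
    (hp : p ∈ (C n)ᗮ) (hq : q ∈ (C n)ᗮ) (hap : a * p = b) (hbq : b * q = a) :
    skew p q ∈ Ann (bracket a b) := by
  obtain ⟨⟨p1, p2⟩, p3, p4⟩ := inner_quotient ha hb hp hap
  obtain ⟨⟨q1, q2⟩, q3, q4⟩ := inner_quotient hb ha hq hbq
  have h := (bracket_mul_eq_zero_iff ha hb hp (neg_mem hq) 0 0 0 1).2
    (by simp [p1, p2, p3, p4, q1, q2, q3, q4, hap, hbq, mul_neg_])
  rw [mem_Ann, skew]
  simpa only [zero_smul, one_smul, zero_add] using h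

theorem Ann_bracket_eq_sup {p q : A (n + 1)} (ha : a ∈ (C n)ᗮ) (hb : b ∈ (C n)ᗮ) (ha0 : a ≠ 0)
    (hb0 : b ≠ 0) (h : herm a b = 0) (haV : a ∈ (Ann b)ᗮ) (hbU : b ∈ (Ann a)ᗮ)
    (hp : p ∈ (C n)ᗮ) (hq : q ∈ (C n)ᗮ) (hap : a * p = b) (hbq : b * q = a) :
    bracketSpace (Ann a) (Ann b) ⊔ cSpan (diagonal a b) ⊔ cSpan (skew p q) =
      Ann (bracket a b) := by
  have hz := bracket_mem ha hb
  have hz0 : bracket a b ≠ 0 := fun h => ha0 (bracket_eq_zero h).1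
  have hskew := cSpan_le_Ann hz hz0 (skew_mem_Ann ha hb hp hq hap hbq)
  refine le_antisymm (sup_le (sup_le (bracketSpace_le_Ann ha hb ha0 hb0 haV hbU)
    (cSpan_le_Ann hz hz0 (diagonal_mem_Ann ha hb ha0 hb0 h))) hskew) fun z hzA => ?_
  obtain ⟨x, hx, y, hy, r₀, r, s₀, s, rfl⟩ := exists_bracket_add z
  obtain ⟨⟨rfl, rfl⟩, -⟩ := quaternion_part_of_mem_Ann ha hb ha0 hb0 hx hy hzA
  have hw : s • skew p q + r • (im (n + 1) * skew p q) ∈ cSpan (skew p q) :=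
    mem_cSpan_iff.2 ⟨s, r, rfl⟩
  simp only [zero_smul, zero_add] at hzA ⊢
  -- Subtracting the complex multiple of `skew p q` with the same quaternion part leaves a pure
  -- bracket, to which the parametrization applies.
  have hd := sub_mem hzA (hskew hw)
  have he := smul_skew_add hp hq r s
  rw [he, add_sub_add_right_eq_sub, bracket_sub] at hd
  obtain ⟨u, hu, v, hv, s', t', hs⟩ := exists_of_bracket_mem_Ann ha hb ha0 hb0
    (sub_mem hx (sub_mem (Submodule.smul_mem _ _ hp) (Submodule.smul_mem _ _ (im_mul_mem hp))))
    (sub_mem hy (neg_mem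
      (add_mem (Submodule.smul_mem _ _ hq) (Submodule.smul_mem _ _ (im_mul_mem hq))))) hd
  have hsum : bracket x y + √2 • mk (r • im n) (s • im n) =
      bracket u v + (s' • diagonal a b + t' • (im (n + 1) * diagonal a b)) +
        (s • skew p q + r • (im (n + 1) * skew p q)) := by
    rw [← hs, he, ← bracket_sub]
    abel
  rw [hsum]
  exact Submodule.add_mem_sup (Submodule.add_mem_sup (mem_bracketSpace.2 ⟨u, hu, v, hv, rfl⟩)
    (mem_cSpan_iff.2 ⟨s', t', rfl⟩)) hw

theorem isCOrthogonalDirectSum_Ann_bracket {p q : A (n + 1)} (ha : a ∈ (C n)ᗮ)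
    (hb : b ∈ (C n)ᗮ) (ha0 : a ≠ 0) (hb0 : b ≠ 0) (h : herm a b = 0) (haV : a ∈ (Ann b)ᗮ)
    (hbU : b ∈ (Ann a)ᗮ) (hp : IsQuotient b a p) (hq : IsQuotient a b q) :
    IsCOrthogonalDirectSum (Ann (bracket a b))
        ![bracketSpace (Ann a) (Ann b), cSpan (diagonal a b), cSpan (skew p q)] ∧
      Module.finrank ℝ (Ann (bracket a b)) =
        Module.finrank ℝ (Ann a) + Module.finrank ℝ (Ann b) + 4 := by
  obtain ⟨hap, hpU⟩ := hp
  obtain ⟨hbq, hqV⟩ := hq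
  obtain ⟨e1, e2⟩ := herm_eq_zero_iff.1 h
  have h' : herm b a = 0 := herm_eq_zero_iff.2
    ⟨by rw [real_inner_comm, e1], by rw [real_inner_comm, inner_im_mul_left, e2, neg_zero]⟩
  have hp := quotient_mem ha ha0 h hap
  have hq := quotient_mem hb hb0 h' hbq
  have i1 : ∀ v ∈ bracketSpace (Ann a) (Ann b), im (n + 1) * v ∈ bracketSpace (Ann a) (Ann b) := by
    intro z hz
    obtain ⟨u, hu, v, hv, rfl⟩ := mem_bracketSpace.1 hz
    rw [im_mul_bracket (Ann_le ha ha0 hu) (Ann_le hb hb0 hv)]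
    exact mem_bracketSpace.2 ⟨_, neg_mem (im_mul_mem_Ann ha ha0 hu), _,
      im_mul_mem_Ann hb hb0 hv, rfl⟩
  have o12 := inner_eq_zero_of_mem_cSpan i1 (w := diagonal a b) <| by
    intro z hz
    obtain ⟨u, hu, v, hv, rfl⟩ := mem_bracketSpace.1 hz
    rw [diagonal, inner_bracket, inner_neg_right, inner_smul_right, inner_smul_right,
      real_inner_comm, (inner_of_mem_Ann ha hu).1, real_inner_comm, (inner_of_mem_Ann hb hv).1]
    simp
  -- Here the normalization of the quotients, orthogonal to `Ann a` and `Ann b`, is what is needed.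
  have o13 := inner_eq_zero_of_mem_cSpan i1 (w := skew p q) <| by
    intro z hz
    obtain ⟨u, hu, v, hv, rfl⟩ := mem_bracketSpace.1 hz
    rw [inner_bracket_skew (Ann_le ha ha0 hu) (Ann_le hb hb0 hv),
      (Submodule.mem_orthogonal _ _).1 hpU u hu, (Submodule.mem_orthogonal _ _).1 hqV v hv,
      sub_zero]
  have o23 := inner_eq_zero_of_mem_cSpan (U := cSpan (diagonal a b)) (w := skew p q)
    (fun _ => im_mul_mem_cSpan) <| by
    intro z hz
    obtain ⟨s, t, rfl⟩ := mem_cSpan_iff.1 hz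
    obtain ⟨⟨p1, p2⟩, p3, p4⟩ := inner_quotient ha hb hp hap
    obtain ⟨⟨q1, q2⟩, q3, q4⟩ := inner_quotient hb ha hq hbq
    rw [smul_diagonal_add ha hb, inner_bracket_skew
      (Submodule.smul_mem _ _ (sub_mem (Submodule.smul_mem _ _ ha)
        (Submodule.smul_mem _ _ (im_mul_mem ha))))
      (neg_mem (Submodule.smul_mem _ _ (add_mem (Submodule.smul_mem _ _ hb)
        (Submodule.smul_mem _ _ (im_mul_mem hb)))))]
    simp [inner_sub_left, inner_add_left, inner_smul_left, inner_im_mul_left, p1, p2, q1, q2]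
  rw [← Ann_bracket_eq_sup ha hb ha0 hb0 h haV hbU hp hq hap hbq]
  refine ⟨isCOrthogonalDirectSum_triple i1 (fun _ => im_mul_mem_cSpan)
    (fun _ => im_mul_mem_cSpan) o12 o13 o23, ?_⟩
  rw [finrank_sup_of_inner_eq_zero, finrank_sup_of_inner_eq_zero o12, finrank_bracketSpace,
    finrank_cSpan (diagonal_ne_zero ha0 hb0), finrank_cSpan (skew_ne_zero hp hq)]
  intro z hz v hv
  obtain ⟨z₁, h₁, z₂, h₂, rfl⟩ := Submodule.mem_sup.1 hz
  rw [inner_add_left, o13 z₁ h₁ v hv, o23 z₂ h₂ v hv, add_zero]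

end DirectSum

end CayleyDickson

open CayleyDickson in
theorem theorem6p4 (n : ℕ) (a b : A (n + 1)) (ha : a ∈ (C n)ᗮ) (hb : b ∈ (C n)ᗮ)
    (ha0 : a ≠ 0) (hb0 : b ≠ 0) :
    (bracket a b ∉ DLocus n →
      Ann (bracket a b) ≤ (H n)ᗮ ∧
      Module.finrank ℝ (Ann (bracket a b)) =
        Module.finrank ℝ (Ann a) + Module.finrank ℝ (Ann b)) ∧
    (bracket a b ∈ DLocus n →
      (∃! p, IsQuotient b a p) ∧ (∃! q, IsQuotient a b q) ∧
      (∀ p q, IsQuotient b a p → IsQuotient a b q →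
        IsCOrthogonalDirectSum (Ann (bracket a b))
          ![bracketSpace (Ann a) (Ann b),
            cSpan (bracket (‖b‖ ^ 2 • a) (-(‖a‖ ^ 2 • b))),
            cSpan (bracket p (-q) + √2 • mk 0 (im n))]) ∧
      Module.finrank ℝ (Ann (bracket a b)) =
        Module.finrank ℝ (Ann a) + Module.finrank ℝ (Ann b) + 4) := by
  refine ⟨fun hD => ⟨Ann_bracket_le_of_notMem ha hb ha0 hb0 hD,
    finrank_Ann_bracket_of_notMem ha hb ha0 hb0 hD⟩, fun hD => ?_⟩
  obtain ⟨h, haV, hbU⟩ := (bracket_mem_DLocus_iff ha hb).1 hD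
  have hp := existsUnique_isQuotient ha hbU
  have hq := existsUnique_isQuotient hb haV
  refine ⟨hp, hq, fun p q hp hq =>
    (isCOrthogonalDirectSum_Ann_bracket ha hb ha0 hb0 h haV hbU hp hq).1, ?_⟩
  obtain ⟨p, hp, -⟩ := hp
  obtain ⟨q, hq, -⟩ := hq
  exact (isCOrthogonalDirectSum_Ann_bracket ha hb ha0 hb0 h haV hbU hp hq).2
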